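/- Let $M$ be a connected, paracompact, Hausdorff smooth 4-manifold with a smooth Lorentzian metric $g$ of signature $(-+++)$, a smooth covector field $Q_\mu$ (the nonmetricity vector: the torsion-free connection $\nabla$ of the Weyl geometry is the one with $\nabla_\alpha g_{\mu\nu}=-Q_\alpha g_{\mu\nu}$) and a smooth nowhere vanishing function $\phi$. Hats denote objects of the Levi-Civita connection of $g$, $Q_{\mu\nu}=\partial_\mu Q_\nu-\partial_\nu Q_\mu$, $Q^2=Q_{\mu\nu}Q^{\mu\nu}$, and $\omega,\lambda,\beta$ are real constants. Let $T_{\mu\nu}$ be a covariant 2-tensor field, the stress-energy tensor of minimally coupled matter, and suppose that the field equations of the gravitational action $$S_g=\frac12\int d^4x\sqrt{-g}\Big[\phi^2\hat R+\omega(\partial\phi)^2+\tfrac{\omega-6}{4}\phi^2Q_\mu Q^\mu+\tfrac{\omega-6}{2}\phi^2\hat\nabla_\mu Q^\mu-\tfrac{\beta^2}{2}Q^2-\tfrac{\lambda}{4}\phi^4\Big]$$ coupled to this matter hold, namely $$\begin{aligned}&\hat G_{\mu\nu}-\tfrac1{\phi^2}\big(\hat\nabla_\mu\hat\nabla_\nu-g_{\mu\nu}\hat\nabla^2\big)\phi^2+\tfrac{\omega}{\phi^2}\big[\partial_\mu\phi\,\partial_\nu\phi-\tfrac12g_{\mu\nu}(\partial\phi)^2\big]+\tfrac{\omega-6}{4}\big(Q_\mu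 Q_\nu-\tfrac12g_{\mu\nu}Q_\lambda Q^\lambda\big)\\&\quad-\tfrac{\omega-6}{2\phi^2}\big[\partial_{(\mu}\phi^2\,Q_{\nu)}-\tfrac12g_{\mu\nu}\partial_\lambda\phi^2\,Q^\lambda\big]-\tfrac{\beta^2}{\phi^2}\big(Q_\mu{}^{\lambda}Q_{\nu\lambda}-\tfrac14g_{\mu\nu}Q^2\big)=\tfrac1{\phi^2}T_{\mu\nu}-\tfrac{\lambda}{8}\phi^2g_{\mu\nu},\end{aligned}$$ $$\beta^2\,\hat\nabla^\mu Q_{\mu\nu}=\tfrac{6-\omega}{4}\big(\phi^2Q_\nu-\partial_\nu\phi^2\big),$$ $$\hat R+\omega\frac{(\partial\phi)^2}{\phi^2}-\frac{\omega}{2}\frac{\hat\nabla^2\phi^2}{\phi^2}+\frac{\omega-6}{4}Q_\mu Q^\mu+\frac{\omega-6}{2}\hat\nabla_\mu Q^\mu-\frac{\lambda}{2}\phi^2=0,$$ where $a_{(\mu}b_{\nu)}=\frac12(a_\mu b_\nu+a_\nu b_\mu)$. Then the matter is massless in the sense that $g^{\mu\nu}T_{\mu\nu}=0$, and it does not interact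 with $Q_\mu$: its stress-energy tensor satisfies the purely Riemannian conservation law $\hat\nabla^\mu T_{\mu\nu}=0$, with no source term depending on $Q_\mu$. -/

import Mathlib

open scoped Manifold ContDiff

noncomputable section

namespace WeylGravity

/-- The model space `ℝ⁴`; coordinates are indexed by `0, 1, 2, 3`. -/
abbrev E4 : Type := EuclideanSpace ℝ (Fin 4)

/-! ### Tensor calculus in one coordinate system

Here `G`, `A`, `B`, `f` are the component functions, on an open set of `ℝ⁴`, of a metric, a
covector field, a covariant 2-tensor field and a scalar field. -/

/-- The partial derivative `∂_μ f`. -/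
def pd (μ : Fin 4) (f : E4 → ℝ) (y : E4) : ℝ :=
  fderiv ℝ f y (EuclideanSpace.single μ (1 : ℝ))

/-- The components `g^{μν}` of the inverse metric. -/
def ginv (G : E4 → Matrix (Fin 4) (Fin 4) ℝ) (μ ν : Fin 4) (y : E4) : ℝ :=
  (G y)⁻¹ μ ν

/-- The Christoffel symbols `{^α_{μν}}` of the Levi-Civita connection. -/
def christoffel (G : E4 → Matrix (Fin 4) (Fin 4) ℝ) (α μ ν : Fin 4) (y : E4) : ℝ :=
  (1 / 2) * ∑ l, ginv G α l y *
    (pd ν (fun z => G z μ l) y + pd μ (fun z => G z ν l) y - pd l (fun z => G z μ ν) y)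

/-- The Riemann-Christoffel curvature tensor `R^α_{σμν}` of the Levi-Civita connection. -/
def riemann (G : E4 → Matrix (Fin 4) (Fin 4) ℝ) (α σ μ ν : Fin 4) (y : E4) : ℝ :=
  pd μ (christoffel G α ν σ) y - pd ν (christoffel G α μ σ) y
    + ∑ l, (christoffel G α μ l y * christoffel G l ν σ y
      - christoffel G α ν l y * christoffel G l μ σ y)

/-- The Levi-Civita Ricci tensor `R_{μν} = R^λ_{μλν}`. -/
def ricci (G : E4 → Matrix (Fin 4) (Fin 4) ℝ) (μ ν : Fin 4) (y : E4) : ℝ :=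
  ∑ l, riemann G l μ l ν y

/-- The trace `g^{μν} B_{μν}`. -/
def trace (G B : E4 → Matrix (Fin 4) (Fin 4) ℝ) (y : E4) : ℝ :=
  ∑ μ, ∑ ν, ginv G μ ν y * B y μ ν

/-- The Levi-Civita curvature scalar. -/
def scalarCurv (G : E4 → Matrix (Fin 4) (Fin 4) ℝ) (y : E4) : ℝ :=
  ∑ μ, ∑ ν, ginv G μ ν y * ricci G μ ν y

/-- The Einstein tensor of the Levi-Civita connection. -/
def einstein (G : E4 → Matrix (Fin 4) (Fin 4) ℝ) (μ ν : Fin 4) (y : E4) : ℝ :=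
  ricci G μ ν y - (1 / 2) * G y μ ν * scalarCurv G y

/-- The Levi-Civita covariant derivative `∇_μ A_ν` of a covector field. -/
def covD1 (G : E4 → Matrix (Fin 4) (Fin 4) ℝ) (A : E4 → Fin 4 → ℝ) (μ ν : Fin 4) (y : E4) : ℝ :=
  pd μ (fun z => A z ν) y - ∑ l, christoffel G l μ ν y * A y l

/-- The Levi-Civita covariant derivative `∇_l B_{μν}` of a covariant 2-tensor field. -/
def covD2 (G B : E4 → Matrix (Fin 4) (Fin 4) ℝ) (l μ ν : Fin 4) (y : E4) : ℝ :=
  pd l (fun z => B z μ ν) y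
    - ∑ k, christoffel G k l μ y * B y k ν - ∑ k, christoffel G k l ν y * B y μ k

/-- The Levi-Civita divergence `∇_μ A^μ = g^{μν} ∇_μ A_ν` of a covector field. -/
def div1 (G : E4 → Matrix (Fin 4) (Fin 4) ℝ) (A : E4 → Fin 4 → ℝ) (y : E4) : ℝ :=
  ∑ μ, ∑ ν, ginv G μ ν y * covD1 G A μ ν y

/-- The Levi-Civita divergence `∇^μ B_{μν}` of a covariant 2-tensor field. -/
def div2 (G B : E4 → Matrix (Fin 4) (Fin 4) ℝ) (ν : Fin 4) (y : E4) : ℝ :=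
  ∑ l, ∑ μ, ginv G l μ y * covD2 G B l μ ν y

/-- The Levi-Civita Hessian `∇_μ ∇_ν f` of a scalar. -/
def hess (G : E4 → Matrix (Fin 4) (Fin 4) ℝ) (f : E4 → ℝ) (μ ν : Fin 4) (y : E4) : ℝ :=
  covD1 G (fun z l => pd l f z) μ ν y

/-- The d'Alembertian `∇² f = g^{μν} ∇_μ ∇_ν f`. -/
def box (G : E4 → Matrix (Fin 4) (Fin 4) ℝ) (f : E4 → ℝ) (y : E4) : ℝ :=
  ∑ μ, ∑ ν, ginv G μ ν y * hess G f μ ν y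

/-- The contraction `g^{μν} a_μ b_ν` at the point `y`. -/
def dot (G : E4 → Matrix (Fin 4) (Fin 4) ℝ) (a b : Fin 4 → ℝ) (y : E4) : ℝ :=
  ∑ μ, ∑ ν, ginv G μ ν y * a μ * b ν

/-- The nonmetricity field strength `Q_{μν} = ∂_μ Q_ν - ∂_ν Q_μ`. -/
def fieldStrength (A : E4 → Fin 4 → ℝ) (y : E4) : Matrix (Fin 4) (Fin 4) ℝ :=
  fun μ ν => pd μ (fun z => A z ν) y - pd ν (fun z => A z μ) y

/-- The contraction `Q_μ{}^λ Q_{νλ}`. -/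
def fieldStrengthProd (G : E4 → Matrix (Fin 4) (Fin 4) ℝ) (A : E4 → Fin 4 → ℝ)
    (μ ν : Fin 4) (y : E4) : ℝ :=
  ∑ k, ∑ l, ginv G k l y * fieldStrength A y μ k * fieldStrength A y ν l

/-- The scalar `Q² = Q_{μν} Q^{μν}`. -/
def fieldStrengthSq (G : E4 → Matrix (Fin 4) (Fin 4) ℝ) (A : E4 → Fin 4 → ℝ) (y : E4) : ℝ :=
  ∑ μ, ∑ ν, ginv G μ ν y * fieldStrengthProd G A μ ν y

/-- The left-hand side `ℰ_{μν}` of the Einstein equation, for the coupling constants `ω`, `β`, the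
metric `G`, the nonmetricity vector `A` (that is, `Q_μ`) and the scalar field `f` (that is, `φ`). -/
def einsteinLHS (om β : ℝ) (G : E4 → Matrix (Fin 4) (Fin 4) ℝ) (A : E4 → Fin 4 → ℝ) (f : E4 → ℝ)
    (μ ν : Fin 4) (y : E4) : ℝ :=
  einstein G μ ν y
    - 1 / f y ^ 2 * (hess G (fun z => f z ^ 2) μ ν y - G y μ ν * box G (fun z => f z ^ 2) y)
    + om / f y ^ 2 * (pd μ f y * pd ν f y
        - 1 / 2 * G y μ ν * dot G (fun l => pd l f y) (fun l => pd l f y) y)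
    + (om - 6) / 4 * (A y μ * A y ν - 1 / 2 * G y μ ν * dot G (A y) (A y) y)
    - (om - 6) / (2 * f y ^ 2) *
        (1 / 2 * (pd μ (fun z => f z ^ 2) y * A y ν + pd ν (fun z => f z ^ 2) y * A y μ)
          - 1 / 2 * G y μ ν * dot G (fun l => pd l (fun z => f z ^ 2) y) (A y) y)
    - β ^ 2 / f y ^ 2 *
        (fieldStrengthProd G A μ ν y - 1 / 4 * G y μ ν * fieldStrengthSq G A y)

/-! ### Tensor fields on a 4-manifold -/

variable (M : Type*) [TopologicalSpace M] [ChartedSpace E4 M]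

/-- Covector fields on `M`. -/
abbrev CovectorField : Type _ := ∀ x : M, TangentSpace (𝓡 4) x →L[ℝ] ℝ

/-- Covariant 2-tensor fields on `M`. -/
abbrev TensorField2 : Type _ :=
  ∀ x : M, TangentSpace (𝓡 4) x →L[ℝ] TangentSpace (𝓡 4) x →L[ℝ] ℝ

/-- The coordinate systems of `M`: the charts of its maximal smooth atlas. -/
abbrev charts : Set (OpenPartialHomeomorph M E4) := IsManifold.maximalAtlas (𝓡 4) ∞ M

variable {M}

/-- The coordinate vector `∂_μ` of the chart `e`, at the point with coordinates `y`. -/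
def coordVec (e : OpenPartialHomeomorph M E4) (y : E4) (μ : Fin 4) :
    TangentSpace (𝓡 4) (e.symm y) :=
  mfderiv (𝓡 4) (𝓡 4) e.symm y (EuclideanSpace.single μ (1 : ℝ) : E4)

/-- The components of a covector field in the chart `e`. -/
def comp1 (e : OpenPartialHomeomorph M E4) (A : CovectorField M) (y : E4) : Fin 4 → ℝ :=
  fun μ => A (e.symm y) (coordVec e y μ)

/-- The components of a covariant 2-tensor field in the chart `e`. -/
def comp2 (e : OpenPartialHomeomorph M E4) (B : TensorField2 M) (y : E4) :
    Matrix (Fin 4) (Fin 4) ℝ :=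
  fun μ ν => B (e.symm y) (coordVec e y μ) (coordVec e y ν)

/-- The coordinate expression of a scalar field in the chart `e`. -/
def comp0 (e : OpenPartialHomeomorph M E4) (f : M → ℝ) (y : E4) : ℝ := f (e.symm y)

/-- A covector field is smooth: its components in all charts are `C^∞`. -/
def SmoothCovector (A : CovectorField M) : Prop :=
  ∀ e ∈ charts M, ∀ μ, ContDiffOn ℝ ∞ (fun y => comp1 e A y μ) e.target

/-- A covariant 2-tensor field is smooth: its components in all charts are `C^∞`. -/
def SmoothTensor2 (B : TensorField2 M) : Prop :=
  ∀ e ∈ charts M, ∀ μ ν, ContDiffOn ℝ ∞ (fun y => comp2 e B y μ ν) e.target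

/-- Smooth symmetric metrics of signature `(-+++)`: every tangent space has a basis in which the
metric is `diag (-1, 1, 1, 1)`. -/
structure IsLorentzMetric (g : TensorField2 M) : Prop where
  smooth : SmoothTensor2 g
  symm : ∀ (x : M) (v w : TangentSpace (𝓡 4) x), g x v w = g x w v
  signature : ∀ x : M, ∃ b : Module.Basis (Fin 4) ℝ (TangentSpace (𝓡 4) x),
    ∀ i j, g x (b i) (b j) = if i = j then (if i = 0 then -1 else 1) else 0

/-! ### The field equations -/

/-- The Einstein equation `ℰ_{μν} = φ⁻² T_{μν} - (λ / 8) φ² g_{μν}`. -/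
def EinsteinEq (om lam β : ℝ) (g : TensorField2 M) (Q : CovectorField M) (φ : M → ℝ)
    (T : TensorField2 M) : Prop :=
  ∀ e ∈ charts M, ∀ y ∈ e.target, ∀ μ ν,
    einsteinLHS om β (comp2 e g) (comp1 e Q) (comp0 e φ) μ ν y
      = 1 / comp0 e φ y ^ 2 * comp2 e T y μ ν
        - lam / 8 * comp0 e φ y ^ 2 * comp2 e g y μ ν

/-- The inhomogeneous Proca equation `β² ∇^μ Q_{μν} = ((6 - ω) / 4) (φ² Q_ν - ∂_ν φ²)`. -/
def ProcaEq (om β : ℝ) (g : TensorField2 M) (Q : CovectorField M) (φ : M → ℝ) : Prop :=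
  ∀ e ∈ charts M, ∀ y ∈ e.target, ∀ ν,
    β ^ 2 * div2 (comp2 e g) (fieldStrength (comp1 e Q)) ν y
      = (6 - om) / 4 * (comp0 e φ y ^ 2 * comp1 e Q y ν - pd ν (fun z => comp0 e φ z ^ 2) y)

/-- The scalar field equation
`R + ω (∂φ)² / φ² - (ω / 2) ∇²φ² / φ² + ((ω - 6) / 4) Q_μ Q^μ + ((ω - 6) / 2) ∇_μ Q^μ - (λ / 2) φ² = 0`,
where `R` is the Levi-Civita curvature scalar. -/
def ScalarEq (om lam : ℝ) (g : TensorField2 M) (Q : CovectorField M) (φ : M → ℝ) : Prop :=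
  ∀ e ∈ charts M, ∀ y ∈ e.target,
    scalarCurv (comp2 e g) y
      + om * dot (comp2 e g) (fun l => pd l (comp0 e φ) y) (fun l => pd l (comp0 e φ) y) y
          / comp0 e φ y ^ 2
      - om / 2 * box (comp2 e g) (fun z => comp0 e φ z ^ 2) y / comp0 e φ y ^ 2
      + (om - 6) / 4 * dot (comp2 e g) (comp1 e Q y) (comp1 e Q y) y
      + (om - 6) / 2 * div1 (comp2 e g) (comp1 e Q) y
      - lam / 2 * comp0 e φ y ^ 2 = 0

/-- The tensor field `T` has vanishing trace `g^{μν} T_{μν}`. -/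
def Traceless (g T : TensorField2 M) : Prop :=
  ∀ e ∈ charts M, ∀ y ∈ e.target, trace (comp2 e g) (comp2 e T) y = 0

/-- The conservation law `∇^μ T_{μν} = 0` for the Levi-Civita connection of `g`. -/
def RiemannConserved (g T : TensorField2 M) : Prop :=
  ∀ e ∈ charts M, ∀ y ∈ e.target, ∀ ν, div2 (comp2 e g) (comp2 e T) ν y = 0

end WeylGravity

end

/-! ### Algebraic Levi-Civita calculus over a ring with commuting derivations. -/

noncomputable section

namespace WeylGravity

/-! Multiplied by `φ²`, the Einstein equation says that `T` is an explicit tensor, `stress`, built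
from `g`, `Q` and `φ`. Both claims become identities for `stress` modulo the two other field
equations.

Since `∇^ν ∇^μ Q_{μν} = 0` identically, the divergence of the Proca equation is `((ω - 6)/4) (∇_μ(φ²
Q^μ) - ∇²φ²) = 0` (`diver1_proca`). The trace of `stress` is minus `φ²` times the scalar equation
plus twice this relation (`tr_stress`).

For the divergence, the reason is diffeomorphism invariance of the action: by Noether's identity
`∇^μ` of the metric equation is a combination of the equations of `φ` and `Q`. The identity is
checked by hand in `diver2_stress`: the contracted Bianchi identity (`diver2_ric`) handles the
curvature, the Ricci identity (`diver2_hess`) the derivatives of `φ²`, and the Maxwell identity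
(`diver2_curlProd`) the quadratic terms in the field strength.

All of this is pure algebra once smooth functions on a chart domain are treated as a commutative
ring with commuting derivations: tensors become matrices over that ring. `smoothOn` supplies the
ring, and `Represents` translates the pointwise coordinate formulas into it. -/

/-- Levi-Civita calculus over a commutative ring of functions: commuting partial derivatives, a
metric with its inverse, and its Levi-Civita connection `conn μ α ν = Γ^α_{μν}`. -/
structure LeviCivita (R : Type*) [CommRing R] [Algebra ℝ R] where
  D : Fin 4 → Derivation ℝ R R
  D_comm : ∀ i j a, D i (D j a) = D j (D i a)
  g : Matrix (Fin 4) (Fin 4) R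
  h : Matrix (Fin 4) (Fin 4) R
  conn : Fin 4 → Matrix (Fin 4) (Fin 4) R
  g_symm : g.transpose = g
  h_symm : h.transpose = h
  h_mul_g : h * g = 1
  torsion : ∀ μ α ν, conn μ α ν = conn ν α μ
  D_g : ∀ l, g.map (D l) = (conn l).transpose * g + g * conn l

namespace LeviCivita

open Matrix

variable {R : Type*} [CommRing R] [Algebra ℝ R]

theorem eq_zero_of_add_self {a : R} (h : a + a = 0) : a = 0 := by
  have h2 : (algebraMap ℝ R (1 / 2)) * (2 : R) = 1 := by
    rw [← map_ofNat (algebraMap ℝ R) 2, ← map_mul]; norm_num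
  linear_combination (algebraMap ℝ R (1 / 2)) * h - a * h2

theorem sum_antisymm_mul_symm {S X : Matrix (Fin 4) (Fin 4) R} (hS : ∀ i j, S i j = -S j i)
    (hX : ∀ i j, X i j = X j i) : ∑ i, ∑ j, S i j * X i j = 0 := by
  apply eq_zero_of_add_self
  nth_rewrite 2 [Finset.sum_comm]
  rw [← Finset.sum_add_distrib]
  refine Finset.sum_eq_zero fun i _ => ?_
  rw [← Finset.sum_add_distrib]
  refine Finset.sum_eq_zero fun j _ => ?_
  rw [hS i j, hX i j]; ring

theorem map_derivation_mul (d : Derivation ℝ R R) (M N : Matrix (Fin 4) (Fin 4) R) :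
    (M * N).map d = M.map d * N + M * N.map d := by
  ext i j
  simp only [map_apply, mul_apply, map_sum, Derivation.leibniz, smul_eq_mul, Matrix.add_apply,
    ← Finset.sum_add_distrib]
  exact Finset.sum_congr rfl fun k _ => by ring

theorem map_derivation_transpose (d : Derivation ℝ R R) (M : Matrix (Fin 4) (Fin 4) R) :
    Mᵀ.map d = (M.map d)ᵀ := rfl

theorem map_derivation_add (d : Derivation ℝ R R) (M N : Matrix (Fin 4) (Fin 4) R) :
    (M + N).map d = M.map d + N.map d := by
  ext i j; simp

theorem map_derivation_sub (d : Derivation ℝ R R) (M N : Matrix (Fin 4) (Fin 4) R) :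
    (M - N).map d = M.map d - N.map d := by
  ext i j; simp

theorem map_derivation_neg (d : Derivation ℝ R R) (M : Matrix (Fin 4) (Fin 4) R) :
    (-M).map d = -M.map d := by
  ext i j; simp

theorem trace_map_derivation (d : Derivation ℝ R R) (M : Matrix (Fin 4) (Fin 4) R) :
    (M.map d).trace = d M.trace := by
  simp [Matrix.trace]

variable (X : LeviCivita R)

theorem map_D_comm (i j : Fin 4) (M : Matrix (Fin 4) (Fin 4) R) :
    (M.map (X.D j)).map (X.D i) = (M.map (X.D i)).map (X.D j) := by
  ext a b; exact X.D_comm i j _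

theorem g_mul_h : X.g * X.h = 1 := mul_eq_one_comm.mp X.h_mul_g

theorem h_comm (i j : Fin 4) : X.h i j = X.h j i := congrFun₂ X.h_symm j i

/-- Differentiate `h * g = 1` and use metric compatibility: the inverse metric is parallel too. -/
theorem D_h (l : Fin 4) : X.h.map (X.D l) = -(X.conn l * X.h) - X.h * (X.conn l)ᵀ := by
  have h1 : X.h.map (X.D l) * X.g + X.h * X.g.map (X.D l) = 0 := by
    rw [← map_derivation_mul, X.h_mul_g]
    ext i j
    by_cases hij : i = j <;> simp [hij]
  calc X.h.map (X.D l) = X.h.map (X.D l) * (X.g * X.h) := by rw [X.g_mul_h, mul_one]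
    _ = (X.h.map (X.D l) * X.g + X.h * X.g.map (X.D l)) * X.h
          - X.h * X.g.map (X.D l) * X.h := by noncomm_ring
    _ = -(X.h * (X.conn l)ᵀ * (X.g * X.h)) - (X.h * X.g) * X.conn l * X.h := by
          rw [h1, X.D_g]; noncomm_ring
    _ = _ := by rw [X.g_mul_h, X.h_mul_g]; noncomm_ring

theorem D_h_apply (l μ ν : Fin 4) : X.D l (X.h μ ν)
    = -(∑ k, X.conn l μ k * X.h k ν) - ∑ k, X.h μ k * X.conn l ν k := by
  have := congrFun₂ (X.D_h l) μ ν
  simpa [mul_apply] using this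

/-! ### Covariant derivatives -/

/-- The covariant derivative `∇_μ w_ν`. -/
def cov1 (w : Fin 4 → R) : Matrix (Fin 4) (Fin 4) R :=
  fun μ ν => X.D μ (w ν) - ∑ l, X.conn μ l ν * w l

/-- The covariant derivative `∇_l B_{μν}`. -/
def cov2 (l : Fin 4) (B : Matrix (Fin 4) (Fin 4) R) : Matrix (Fin 4) (Fin 4) R :=
  B.map (X.D l) - (X.conn l)ᵀ * B - B * X.conn l

/-- The contraction `g^{μν} B_{μν}`. -/
def tr (B : Matrix (Fin 4) (Fin 4) R) : R := ∑ μ, ∑ ν, X.h μ ν * B μ ν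

/-- The contraction `g^{μν} a_μ b_ν`. -/
def ip (a b : Fin 4 → R) : R := ∑ μ, ∑ ν, X.h μ ν * a μ * b ν

/-- The divergence `∇^μ w_μ`. -/
def diver1 (w : Fin 4 → R) : R := X.tr (X.cov1 w)

/-- The divergence `∇^μ B_{μν}`. -/
def diver2 (B : Matrix (Fin 4) (Fin 4) R) (ν : Fin 4) : R :=
  ∑ l, ∑ μ, X.h l μ * X.cov2 l B μ ν

/-- The gradient of a scalar. -/
def grad (a : R) : Fin 4 → R := fun μ => X.D μ a

/-- The curl `∂_μ w_ν - ∂_ν w_μ`. -/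
def curl (w : Fin 4 → R) : Matrix (Fin 4) (Fin 4) R := fun μ ν => X.D μ (w ν) - X.D ν (w μ)

theorem tr_eq_trace (B : Matrix (Fin 4) (Fin 4) R) : X.tr B = (X.h * B).trace := by
  simp only [tr, Matrix.trace, diag_apply, mul_apply]
  rw [Finset.sum_comm]
  simp_rw [X.h_comm]

theorem cov2_apply (l μ ν : Fin 4) (B : Matrix (Fin 4) (Fin 4) R) :
    X.cov2 l B μ ν
      = X.D l (B μ ν) - ∑ k, X.conn l k μ * B k ν - ∑ k, B μ k * X.conn l k ν := by
  simp [cov2, mul_apply]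

theorem cov2_add (l : Fin 4) (B C : Matrix (Fin 4) (Fin 4) R) :
    X.cov2 l (B + C) = X.cov2 l B + X.cov2 l C := by
  simp only [cov2, map_derivation_add]; noncomm_ring

theorem cov2_sub (l : Fin 4) (B C : Matrix (Fin 4) (Fin 4) R) :
    X.cov2 l (B - C) = X.cov2 l B - X.cov2 l C := by
  simp only [cov2, map_derivation_sub]; noncomm_ring

theorem cov2_smul (l : Fin 4) (s : R) (B : Matrix (Fin 4) (Fin 4) R) :
    X.cov2 l (s • B) = X.D l s • B + s • X.cov2 l B := by
  have : (s • B).map (X.D l) = X.D l s • B + s • B.map (X.D l) := by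
    ext i j; simp; ring
  rw [cov2, cov2, this, mul_smul_comm, smul_mul_assoc, smul_sub, smul_sub]
  abel

theorem cov2_g (l : Fin 4) : X.cov2 l X.g = 0 := by
  rw [cov2, X.D_g]; abel

theorem cov2_transpose (l : Fin 4) (B : Matrix (Fin 4) (Fin 4) R) :
    X.cov2 l Bᵀ = (X.cov2 l B)ᵀ := by
  simp only [cov2, transpose_sub, transpose_mul, transpose_transpose, map_derivation_transpose]
  abel

theorem cov2_mul_h_mul (l : Fin 4) (B C : Matrix (Fin 4) (Fin 4) R) :
    X.cov2 l (B * X.h * C) = X.cov2 l B * X.h * C + B * X.h * X.cov2 l C := by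
  simp only [cov2, map_derivation_mul, X.D_h]
  noncomm_ring

theorem cov2_vecMulVec (l : Fin 4) (w v : Fin 4 → R) (μ ν : Fin 4) :
    X.cov2 l (vecMulVec w v) μ ν = X.cov1 w l μ * v ν + w μ * X.cov1 v l ν := by
  simp only [cov2_apply, cov1, vecMulVec_apply, Derivation.leibniz, smul_eq_mul, Finset.mul_sum,
    mul_sub, sub_mul, Finset.sum_mul]
  simp only [Fin.sum_univ_four]; ring

/-- The inverse metric is parallel, so contraction commutes with `∇`; the remaining connection terms
agree by cyclicity of the matrix trace. -/
theorem D_tr (l : Fin 4) (B : Matrix (Fin 4) (Fin 4) R) :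
    X.D l (X.tr B) = X.tr (X.cov2 l B) := by
  rw [tr_eq_trace, tr_eq_trace, ← trace_map_derivation, map_derivation_mul, X.D_h, cov2]
  have := trace_mul_comm (X.conn l) (X.h * B)
  simp only [sub_mul, neg_mul, mul_sub, trace_add, trace_sub, trace_neg, mul_assoc] at this ⊢
  rw [this]; ring

theorem tr_vecMulVec (w v : Fin 4 → R) : X.tr (vecMulVec w v) = X.ip w v := by
  simp only [tr, ip, vecMulVec_apply, mul_assoc]

theorem tr_add (B C : Matrix (Fin 4) (Fin 4) R) : X.tr (B + C) = X.tr B + X.tr C := by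
  simp only [tr, Matrix.add_apply, mul_add, Finset.sum_add_distrib]

theorem tr_sub (B C : Matrix (Fin 4) (Fin 4) R) : X.tr (B - C) = X.tr B - X.tr C := by
  simp only [tr, Matrix.sub_apply, mul_sub, Finset.sum_sub_distrib]

theorem tr_smul (s : R) (B : Matrix (Fin 4) (Fin 4) R) : X.tr (s • B) = s * X.tr B := by
  simp only [tr, Matrix.smul_apply, smul_eq_mul, Finset.mul_sum]
  exact Finset.sum_congr rfl fun _ _ => Finset.sum_congr rfl fun _ _ => by ring

theorem tr_g : X.tr X.g = 4 := by
  rw [tr_eq_trace, X.h_mul_g, trace_one]; simp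

theorem ip_comm (w v : Fin 4 → R) : X.ip w v = X.ip v w := by
  simp only [ip]
  rw [Finset.sum_comm]
  refine Finset.sum_congr rfl fun i _ => Finset.sum_congr rfl fun j _ => ?_
  rw [X.h_comm j i]; ring

theorem diver2_add (B C : Matrix (Fin 4) (Fin 4) R) (ν : Fin 4) :
    X.diver2 (B + C) ν = X.diver2 B ν + X.diver2 C ν := by
  simp only [diver2, cov2_add, Matrix.add_apply, mul_add, Finset.sum_add_distrib]

theorem diver2_sub (B C : Matrix (Fin 4) (Fin 4) R) (ν : Fin 4) :
    X.diver2 (B - C) ν = X.diver2 B ν - X.diver2 C ν := by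
  simp only [diver2, cov2_sub, Matrix.sub_apply, mul_sub, Finset.sum_sub_distrib]

theorem diver2_smul (s : R) (B : Matrix (Fin 4) (Fin 4) R) (ν : Fin 4) :
    X.diver2 (s • B) ν = X.ip (X.grad s) (fun μ => B μ ν) + s * X.diver2 B ν := by
  simp only [diver2, cov2_smul, Matrix.add_apply, Matrix.smul_apply, smul_eq_mul, mul_add,
    Finset.sum_add_distrib, ip, grad, Finset.mul_sum]
  congr 1 <;>
  exact Finset.sum_congr rfl fun _ _ => Finset.sum_congr rfl fun _ _ => by ring

theorem diver2_smul_g (s : R) (ν : Fin 4) : X.diver2 (s • X.g) ν = X.D ν s := by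
  rw [diver2_smul]
  simp only [diver2, cov2_g, Matrix.zero_apply, mul_zero, Finset.sum_const_zero, add_zero, ip, grad]
  have : ∀ l, ∑ μ, X.h l μ * X.D l s * X.g μ ν = X.D l s * (X.h * X.g) l ν := fun l => by
    rw [mul_apply, Finset.mul_sum]; exact Finset.sum_congr rfl fun _ _ => by ring
  simp only [this, X.h_mul_g, Matrix.one_apply]
  simp

theorem diver2_vecMulVec (w v : Fin 4 → R) (ν : Fin 4) :
    X.diver2 (vecMulVec w v) ν
      = X.diver1 w * v ν + X.ip w (fun l => X.cov1 v l ν) := by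
  rw [ip_comm]
  simp only [diver2, cov2_vecMulVec, diver1, tr, ip, Finset.sum_mul, ← Finset.sum_add_distrib]
  exact Finset.sum_congr rfl fun _ _ => Finset.sum_congr rfl fun _ _ => by ring

theorem D_ip (ν : Fin 4) (w v : Fin 4 → R) :
    X.D ν (X.ip w v) = X.ip w (X.cov1 v ν) + X.ip v (X.cov1 w ν) := by
  rw [← tr_vecMulVec, D_tr, X.ip_comm v]
  simp only [tr, cov2_vecMulVec, ip, ← Finset.sum_add_distrib]
  exact Finset.sum_congr rfl fun _ _ => Finset.sum_congr rfl fun _ _ => by ring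

theorem ip_sub (w u v : Fin 4 → R) : X.ip w (u - v) = X.ip w u - X.ip w v := by
  simp only [ip, Pi.sub_apply, mul_sub, Finset.sum_sub_distrib]

theorem ip_smul (s : R) (w v : Fin 4 → R) : X.ip w (s • v) = s * X.ip w v := by
  simp only [ip, Pi.smul_apply, smul_eq_mul, Finset.mul_sum]
  exact Finset.sum_congr rfl fun _ _ => Finset.sum_congr rfl fun _ _ => by ring

theorem ip_g (w : Fin 4 → R) (ν : Fin 4) : X.ip w (fun μ => X.g μ ν) = w ν := by
  have : ∀ l, ∑ μ, X.h l μ * w l * X.g μ ν = w l * (X.h * X.g) l ν := fun l => by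
    rw [mul_apply, Finset.mul_sum]; exact Finset.sum_congr rfl fun _ _ => by ring
  simp only [ip, this, X.h_mul_g, Matrix.one_apply]
  simp

theorem cov1_sub_cov1 (w : Fin 4 → R) (μ ν : Fin 4) :
    X.cov1 w μ ν - X.cov1 w ν μ = X.curl w μ ν := by
  simp only [cov1, curl, fun k => X.torsion μ k ν]; ring

theorem cov1_grad_symm (a : R) (μ ν : Fin 4) :
    X.cov1 (X.grad a) μ ν = X.cov1 (X.grad a) ν μ := by
  have := X.cov1_sub_cov1 (X.grad a) μ ν
  simp only [curl, grad, X.D_comm μ ν, sub_self] at this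
  exact sub_eq_zero.mp this

theorem diver1_add (w v : Fin 4 → R) : X.diver1 (w + v) = X.diver1 w + X.diver1 v := by
  have : X.cov1 (w + v) = X.cov1 w + X.cov1 v := by
    ext i j; simp only [cov1, Pi.add_apply, map_add, mul_add, Finset.sum_add_distrib, Matrix.add_apply]
    ring
  rw [diver1, this, tr_add]; rfl

theorem diver1_smul (s : R) (w : Fin 4 → R) :
    X.diver1 (s • w) = X.ip (X.grad s) w + s * X.diver1 w := by
  have : X.cov1 (s • w) = vecMulVec (X.grad s) w + s • X.cov1 w := by
    ext i j
    simp only [cov1, Pi.smul_apply, smul_eq_mul, Derivation.leibniz, vecMulVec_apply, grad,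
      Matrix.add_apply, Matrix.smul_apply, mul_sub, Finset.mul_sum]
    have : ∀ k, X.conn i k j * (s * w k) = s * (X.conn i k j * w k) := fun k => by ring
    simp only [this]; ring
  rw [diver1, this, tr_add, tr_vecMulVec, tr_smul]; rfl

end LeviCivita

end WeylGravity

end

/-! ### Bianchi and Ricci identities, and the Maxwell identities for the field strength. -/

noncomputable section

namespace WeylGravity

namespace LeviCivita

open Matrix

variable {R : Type*} [CommRing R] [Algebra ℝ R] (X : LeviCivita R)

/-! ### Curvature -/

/-- The curvature `R^α_{σμν}` as a matrix in `α`, `σ`. -/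
def riem (μ ν : Fin 4) : Matrix (Fin 4) (Fin 4) R :=
  (X.conn ν).map (X.D μ) - (X.conn μ).map (X.D ν) + X.conn μ * X.conn ν - X.conn ν * X.conn μ

/-- The Ricci tensor `R_{μν} = R^λ_{μλν}`. -/
def ric : Matrix (Fin 4) (Fin 4) R := fun μ ν => ∑ l, X.riem l ν l μ

/-- The curvature with the second index raised, `R^{αβ}_{μν}`. -/
def riemUp (μ ν : Fin 4) : Matrix (Fin 4) (Fin 4) R := X.riem μ ν * X.h

theorem riem_swap (μ ν : Fin 4) : X.riem μ ν = -X.riem ν μ := by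
  simp only [riem]; abel

theorem riemUp_swap (μ ν : Fin 4) : X.riemUp μ ν = -X.riemUp ν μ := by
  rw [riemUp, riem_swap, neg_mul]; rfl

/-- The commutator of covariant derivatives annihilates the parallel tensor `h`; concretely, this is
the equality of the mixed second derivatives of `h` with `D_h` substituted twice. -/
theorem riemUp_transpose (μ ν : Fin 4) : (X.riemUp μ ν)ᵀ = -X.riemUp μ ν := by
  have key := X.map_D_comm μ ν X.h
  simp only [X.D_h, map_derivation_sub, map_derivation_neg, map_derivation_mul,
    map_derivation_transpose] at key
  rw [← sub_eq_zero] at key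
  rw [← add_eq_zero_iff_eq_neg]
  simp only [riemUp, riem, transpose_mul, transpose_add, transpose_sub, X.h_symm]
  rw [← neg_eq_zero, ← key]
  noncomm_ring

theorem riemUp_antisymm (μ ν α β : Fin 4) : X.riemUp μ ν α β = -X.riemUp μ ν β α :=
  congrFun₂ (X.riemUp_transpose μ ν) β α

theorem trace_riem (μ ν : Fin 4) : (X.riem μ ν).trace = 0 := by
  have : X.riem μ ν = X.riemUp μ ν * X.g := by
    rw [riemUp, mul_assoc, X.h_mul_g, mul_one]
  rw [this, Matrix.trace]
  simp only [diag_apply, mul_apply]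
  refine sum_antisymm_mul_symm (X := X.g.transpose) (X.riemUp_antisymm μ ν) fun i j => ?_
  rw [X.g_symm]
  exact (congrFun₂ X.g_symm i j).symm

/-- `riem μ ν` is the commutator of the operators `∂_μ + Γ_μ` and `∂_ν + Γ_ν`, so this is the Jacobi
identity. -/
theorem second_bianchi (l μ ν : Fin 4) :
    ((X.riem μ ν).map (X.D l) + X.conn l * X.riem μ ν - X.riem μ ν * X.conn l)
      + ((X.riem ν l).map (X.D μ) + X.conn μ * X.riem ν l - X.riem ν l * X.conn μ)
      + ((X.riem l μ).map (X.D ν) + X.conn ν * X.riem l μ - X.riem l μ * X.conn ν) = 0 := by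
  simp only [riem, map_derivation_sub, map_derivation_add, map_derivation_mul,
    X.map_D_comm μ l, X.map_D_comm ν l, X.map_D_comm ν μ]
  noncomm_ring

/-- The covariant derivative `∇_l R^{αβ}_{μν}`, without the connection terms of `μ` and `ν`. -/
def dRiemUp (l μ ν : Fin 4) : Matrix (Fin 4) (Fin 4) R :=
  (X.riemUp μ ν).map (X.D l) + X.conn l * X.riemUp μ ν + X.riemUp μ ν * (X.conn l)ᵀ

/-- The connection terms that `dRiemUp` omits would cancel in the cyclic sum by vanishing torsion,
so the Bianchi identity already holds without them. -/
theorem dRiemUp_cyclic (l μ ν : Fin 4) :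
    X.dRiemUp l μ ν + X.dRiemUp μ ν l + X.dRiemUp ν l μ = 0 := by
  have := congrArg (· * X.h) (X.second_bianchi l μ ν)
  simp only [zero_mul] at this
  rw [← this]
  simp only [dRiemUp, riemUp, map_derivation_mul, X.D_h]
  noncomm_ring

/-- The mixed Ricci tensor `R^β_ν`, as `∑ α, R^{αβ}_{αν}`. -/
def ricUp : Matrix (Fin 4) (Fin 4) R := fun β ν => ∑ α, X.riemUp α ν α β

theorem h_mul_ric : X.h * X.ric = X.ricUp := by
  ext β ν
  simp only [mul_apply, ric, ricUp, riemUp, Finset.mul_sum]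
  rw [Finset.sum_comm]
  exact Finset.sum_congr rfl fun l _ => Finset.sum_congr rfl fun k _ => by
    rw [X.h_comm β k, mul_comm]

theorem diver2_eq_raised (B : Matrix (Fin 4) (Fin 4) R) (ν : Fin 4) :
    X.diver2 B ν = ∑ l, (X.D l ((X.h * B) l ν) + ∑ k, X.conn l l k * (X.h * B) k ν
      - ∑ k, (X.h * B) l k * X.conn l k ν) := by
  have : ∀ l, X.h * X.cov2 l B = (X.h * B).map (X.D l) + X.conn l * (X.h * B)
      - (X.h * B) * X.conn l := fun l => by
    simp only [cov2, map_derivation_mul, X.D_h]; noncomm_ring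
  simp only [diver2]
  refine Finset.sum_congr rfl fun l _ => ?_
  rw [← mul_apply, this]
  simp only [Matrix.sub_apply, Matrix.add_apply, mul_apply, map_apply]

theorem sum_sum_conn_mul_antisymm (S : Matrix (Fin 4) (Fin 4) R) (hS : ∀ i j, S i j = -S j i)
    (ν : Fin 4) : ∑ l, ∑ k, S l k * X.conn l ν k = 0 :=
  sum_antisymm_mul_symm (X := fun l k => X.conn l ν k) hS fun i j => X.torsion i ν j

/-- Contract the second Bianchi identity over both index pairs: by the antisymmetries of
`R^{αβ}_{μν}`, two of the three terms coincide and each yields minus the divergence of Ricci, while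
the third yields `∂_ν R`. Written as a sum of two equal terms to avoid a factor `1/2` in `R`. -/
theorem diver2_ric (ν : Fin 4) :
    X.diver2 X.ric ν + X.diver2 X.ric ν = X.D ν (X.tr X.ric) := by
  have h0 : ∑ μ, ∑ l, (X.dRiemUp ν μ l + X.dRiemUp μ l ν + X.dRiemUp l ν μ) μ l = 0 := by
    simp only [dRiemUp_cyclic, Matrix.zero_apply, Finset.sum_const_zero]
  have h1 : ∑ μ, ∑ l, X.dRiemUp l ν μ μ l = ∑ μ, ∑ l, X.dRiemUp μ l ν μ l := by
    rw [Finset.sum_comm]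
    refine Finset.sum_congr rfl fun μ _ => Finset.sum_congr rfl fun l _ => ?_
    have h2 : X.dRiemUp μ ν l = -X.dRiemUp μ l ν := by
      rw [dRiemUp, riemUp_swap, dRiemUp, map_derivation_neg]; noncomm_ring
    have h3 : (X.dRiemUp μ l ν)ᵀ = -X.dRiemUp μ l ν := by
      simp only [dRiemUp, transpose_add, transpose_mul, ← map_derivation_transpose,
        riemUp_transpose, map_derivation_neg, transpose_transpose]
      noncomm_ring
    rw [h2]
    have := congrFun₂ h3 l μ
    rw [transpose_apply, Matrix.neg_apply] at this
    rw [Matrix.neg_apply, this]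
  have hP : ∀ μ k, ∑ l, X.riemUp μ l k l = X.ricUp k μ := fun μ k => by
    rw [ricUp]
    refine Finset.sum_congr rfl fun l _ => ?_
    rw [riemUp_swap, Matrix.neg_apply, X.riemUp_antisymm l μ k l, neg_neg]
  -- `dRiemUp` is not a full covariant derivative, so its contraction leaves a term `2 Γ·Ric`; it
  -- cancels against the single `-Γ·Ric` in `h3`, which occurs twice.
  have h2 : ∑ μ, ∑ l, X.dRiemUp ν μ l μ l = X.D ν (X.tr X.ric)
      + 2 * ∑ μ, ∑ k, X.conn ν μ k * X.ricUp k μ := by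
    have c1 : X.tr X.ric = ∑ μ, ∑ l, X.riemUp μ l μ l := by
      rw [tr_eq_trace, h_mul_ric, Finset.sum_comm]; rfl
    have c2 : ∑ μ, ∑ l, ∑ k, X.conn ν μ k * X.riemUp μ l k l
        = ∑ μ, ∑ k, X.conn ν μ k * X.ricUp k μ := by
      refine Finset.sum_congr rfl fun μ _ => ?_
      rw [Finset.sum_comm]
      exact Finset.sum_congr rfl fun k _ => by rw [← Finset.mul_sum, hP]
    have c3 : ∑ μ, ∑ l, ∑ k, X.riemUp μ l μ k * X.conn ν l k
        = ∑ μ, ∑ k, X.conn ν μ k * X.ricUp k μ := by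
      rw [Finset.sum_comm]
      refine Finset.sum_congr rfl fun l _ => ?_
      rw [Finset.sum_comm]
      exact Finset.sum_congr rfl fun k _ => by rw [← Finset.sum_mul, mul_comm]; rfl
    simp only [dRiemUp, Matrix.add_apply, mul_apply, map_apply, transpose_apply,
      Finset.sum_add_distrib]
    rw [c1, c2, c3]
    simp only [map_sum]
    ring
  have h3 : ∑ μ, ∑ l, X.dRiemUp μ l ν μ l
      = -X.diver2 X.ric ν - ∑ μ, ∑ k, X.conn ν μ k * X.ricUp k μ := by
    have hN : ∀ μ, ∑ l, X.riemUp l ν μ l = -X.ricUp μ ν := fun μ => by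
      rw [ricUp, ← Finset.sum_neg_distrib]
      exact Finset.sum_congr rfl fun l _ => X.riemUp_antisymm _ _ _ _
    have c1 : ∑ μ, ∑ l, X.D μ (X.riemUp l ν μ l) = -∑ μ, X.D μ (X.ricUp μ ν) := by
      simp only [← map_sum, hN, map_neg, Finset.sum_neg_distrib]
    have c2 : ∑ μ, ∑ l, ∑ k, X.conn μ μ k * X.riemUp l ν k l
        = -∑ μ, ∑ k, X.conn μ μ k * X.ricUp k ν := by
      rw [← Finset.sum_neg_distrib]
      refine Finset.sum_congr rfl fun μ _ => ?_
      rw [Finset.sum_comm, ← Finset.sum_neg_distrib]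
      exact Finset.sum_congr rfl fun k _ => by rw [← Finset.mul_sum, hN, mul_neg]
    have c3 : ∑ μ, ∑ l, ∑ k, X.riemUp l ν μ k * X.conn μ l k = 0 := by
      rw [Finset.sum_comm]
      exact Finset.sum_eq_zero fun l _ =>
        X.sum_sum_conn_mul_antisymm (X.riemUp l ν) (X.riemUp_antisymm l ν) l
    have c4 : ∑ l, ∑ k, X.ricUp l k * X.conn l k ν = ∑ μ, ∑ k, X.conn ν μ k * X.ricUp k μ := by
      rw [Finset.sum_comm]
      exact Finset.sum_congr rfl fun k _ => Finset.sum_congr rfl fun l _ => by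
        rw [X.torsion l k ν, mul_comm]
    rw [diver2_eq_raised, h_mul_ric]
    simp only [dRiemUp, Matrix.add_apply, mul_apply, map_apply, transpose_apply,
      Finset.sum_add_distrib, Finset.sum_sub_distrib]
    rw [c1, c2, c3, c4]
    ring
  simp only [Matrix.add_apply, Finset.sum_add_distrib] at h0
  rw [h1, h2, h3] at h0
  linear_combination -h0

/-- The Ricci identity for covectors. -/
theorem cov2_cov1 (w : Fin 4 → R) (l ν μ : Fin 4) :
    X.cov2 l (X.cov1 w) ν μ - X.cov2 ν (X.cov1 w) l μ = -∑ s, X.riem l ν s μ * w s := by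
  simp only [cov2_apply, cov1, riem, Matrix.sub_apply, Matrix.add_apply, map_apply, mul_apply,
    map_sub, map_sum, Derivation.leibniz, smul_eq_mul, X.D_comm ν l, fun k => X.torsion ν k l]
  simp only [Fin.sum_univ_four]
  ring

/-- The Hessian is symmetric, so its divergence differs from `∂_ν ∇²a` only by commuting two
covariant derivatives on the gradient, which costs a Ricci term. -/
theorem diver2_hess (a : R) (ν : Fin 4) :
    X.diver2 (X.cov1 (X.grad a)) ν - X.D ν (X.tr (X.cov1 (X.grad a)))
      = X.ip (X.grad a) (fun μ => X.ric μ ν) := by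
  have hsymm : (X.cov1 (X.grad a))ᵀ = X.cov1 (X.grad a) := by
    ext i j; exact X.cov1_grad_symm a j i
  have h1 : ∀ l μ, X.cov2 l (X.cov1 (X.grad a)) μ ν = X.cov2 l (X.cov1 (X.grad a)) ν μ := by
    intro l μ
    conv_lhs => rw [← hsymm, cov2_transpose]
    rfl
  have h2 : ∀ l, ∑ μ, X.h l μ * ∑ s, X.riem l ν s μ * X.grad a s
      = ∑ s, X.riemUp l ν s l * X.grad a s := by
    intro l
    simp only [riemUp, mul_apply, Finset.mul_sum, Finset.sum_mul]
    rw [Finset.sum_comm]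
    refine Finset.sum_congr rfl fun s _ => Finset.sum_congr rfl fun μ _ => ?_
    rw [X.h_comm l μ]; ring
  have h3 : ∀ s, ∑ l, X.riemUp l ν s l = -∑ μ, X.h s μ * X.ric μ ν := by
    intro s
    rw [← mul_apply, h_mul_ric, ricUp, ← Finset.sum_neg_distrib]
    exact Finset.sum_congr rfl fun l _ => X.riemUp_antisymm _ _ _ _
  rw [D_tr]
  simp only [diver2, tr, ← Finset.sum_sub_distrib, ← mul_sub, h1, cov2_cov1, mul_neg,
    Finset.sum_neg_distrib, h2]
  rw [Finset.sum_comm]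
  simp only [← Finset.sum_mul, h3, ip, neg_mul, Finset.sum_neg_distrib, neg_neg]
  refine Finset.sum_congr rfl fun s _ => ?_
  rw [Finset.sum_mul]
  exact Finset.sum_congr rfl fun μ _ => by ring

/-! ### The field strength -/

theorem curl_antisymm (w : Fin 4 → R) (i j : Fin 4) : X.curl w i j = -X.curl w j i := by
  simp only [curl]; ring

theorem curl_transpose (w : Fin 4 → R) : (X.curl w)ᵀ = -X.curl w := by
  ext i j; exact X.curl_antisymm w j i

theorem cov2_curl_antisymm (w : Fin 4 → R) (l i j : Fin 4) :
    X.cov2 l (X.curl w) i j = -X.cov2 l (X.curl w) j i := by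
  have : (X.cov2 l (X.curl w))ᵀ = -X.cov2 l (X.curl w) := by
    rw [← cov2_transpose, curl_transpose, ← neg_one_smul R (X.curl w), cov2_smul]
    simp
  exact congrFun₂ this j i

/-- This is `dF = 0` for `F = dw`; the connection terms cancel by symmetry of `Γ`. -/
theorem cov2_curl_cyclic (w : Fin 4 → R) (l μ ν : Fin 4) :
    X.cov2 l (X.curl w) μ ν + X.cov2 μ (X.curl w) ν l + X.cov2 ν (X.curl w) l μ = 0 := by
  simp only [cov2_apply, curl, map_sub, X.D_comm μ l, X.D_comm ν l, X.D_comm ν μ,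
    fun k => X.torsion μ k l, fun k => X.torsion ν k l, fun k => X.torsion ν k μ]
  simp only [Fin.sum_univ_four]
  ring

/-- The field strength with both indices raised. -/
def curlUp (w : Fin 4 → R) : Matrix (Fin 4) (Fin 4) R := X.h * X.curl w * X.h

theorem curlUp_antisymm (w : Fin 4 → R) (i j : Fin 4) : X.curlUp w i j = -X.curlUp w j i := by
  have : (X.curlUp w)ᵀ = -X.curlUp w := by
    simp only [curlUp, transpose_mul, X.h_symm, curl_transpose]; noncomm_ring
  exact congrFun₂ this j i

theorem diver1_eq_raised (w : Fin 4 → R) :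
    X.diver1 w = ∑ μ, (X.D μ ((X.h *ᵥ w) μ) + ∑ k, X.conn μ μ k * (X.h *ᵥ w) k) := by
  simp only [diver1, tr, cov1, mulVec, dotProduct, map_sum, Derivation.leibniz, smul_eq_mul,
    X.D_h_apply]
  simp only [Fin.sum_univ_four]
  ring

/-- Classically `Γ^α_{μα} = ∂_μ log √|g|` is a gradient. Its closedness is all that is needed, and
it follows from `trace_riem` without introducing a square root. -/
theorem D_trace_conn_comm (μ ν : Fin 4) :
    X.D μ (X.conn ν).trace = X.D ν (X.conn μ).trace := by
  have := X.trace_riem μ ν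
  rw [riem, trace_sub, trace_add, trace_sub, trace_mul_comm (X.conn ν), trace_map_derivation,
    trace_map_derivation] at this
  linear_combination this

/-- The algebraic form of `∇_l F^{lν} = |g|^{-1/2} ∂_l (|g|^{1/2} F^{lν})`: the term `Γ^ν_{lk}
F^{lk}` drops out because `F` is antisymmetric. -/
theorem h_mulVec_diver2_curl (w : Fin 4 → R) (ν : Fin 4) :
    (X.h *ᵥ X.diver2 (X.curl w)) ν
      = ∑ l, (X.D l (X.curlUp w l ν) + (X.conn l).trace * X.curlUp w l ν) := by
  have h1 : ∀ l, X.h * X.cov2 l (X.curl w) * X.h = (X.curlUp w).map (X.D l)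
      + X.conn l * X.curlUp w + X.curlUp w * (X.conn l)ᵀ := fun l => by
    simp only [curlUp, cov2, map_derivation_mul, X.D_h]; noncomm_ring
  have h2 : (X.h *ᵥ X.diver2 (X.curl w)) ν = ∑ l, (X.h * X.cov2 l (X.curl w) * X.h) l ν := by
    simp only [mulVec, dotProduct, diver2, mul_apply, Finset.mul_sum, Finset.sum_mul]
    rw [Finset.sum_comm]
    refine Finset.sum_congr rfl fun l _ => Finset.sum_congr rfl fun k _ =>
      Finset.sum_congr rfl fun m _ => ?_
    rw [X.h_comm ν k]; ring
  have h3 := X.sum_sum_conn_mul_antisymm (X.curlUp w) (X.curlUp_antisymm w) ν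
  have h4 : ∑ l, ∑ k, X.conn l l k * X.curlUp w k ν
      = ∑ l, (X.conn l).trace * X.curlUp w l ν := by
    rw [Finset.sum_comm]
    refine Finset.sum_congr rfl fun k _ => ?_
    rw [← Finset.sum_mul, Matrix.trace]
    congr 1
    exact Finset.sum_congr rfl fun l _ => X.torsion l l k
  rw [h2]
  simp only [h1, Matrix.add_apply, map_apply, mul_apply (M := X.conn _),
    mul_apply (M := X.curlUp w), transpose_apply, Finset.sum_add_distrib]
  rw [h3, h4, add_zero]

/-- With `τ_l = (conn l).trace`, the double divergence is `(∂_m + τ_m)(∂_l + τ_l) F^{lm}`. The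
operators commute because `τ` is closed, and `F` is antisymmetric. The terms with zero, two and one
derivatives of `F` vanish separately, in `h5`, `h6` and `h7`. -/
theorem diver1_diver2_curl (w : Fin 4 → R) : X.diver1 (X.diver2 (X.curl w)) = 0 := by
  have h4 : ∀ V : Fin 4 → R, ∑ μ, ∑ k, X.conn μ μ k * V k = ∑ k, (X.conn k).trace * V k := by
    intro V
    rw [Finset.sum_comm]
    refine Finset.sum_congr rfl fun k _ => ?_
    rw [← Finset.sum_mul, Matrix.trace]
    congr 1
    exact Finset.sum_congr rfl fun l _ => X.torsion l l k
  rw [diver1_eq_raised, Finset.sum_add_distrib, h4, ← Finset.sum_add_distrib]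
  simp only [h_mulVec_diver2_curl, map_sum, Finset.mul_sum, ← Finset.sum_add_distrib]
  have h5 := sum_antisymm_mul_symm (S := fun m l => X.curlUp w l m) (X := fun m l =>
    X.D m (X.conn l).trace + (X.conn m).trace * (X.conn l).trace)
    (fun i j => X.curlUp_antisymm w j i)
    (fun i j => by rw [X.D_trace_conn_comm i j]; ring)
  have h6 : ∑ m, ∑ l, X.D m (X.D l (X.curlUp w l m)) = 0 := by
    apply eq_zero_of_add_self
    nth_rewrite 2 [Finset.sum_comm]
    rw [← Finset.sum_add_distrib]
    refine Finset.sum_eq_zero fun i _ => ?_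
    rw [← Finset.sum_add_distrib]
    refine Finset.sum_eq_zero fun j _ => ?_
    rw [X.D_comm i j, X.curlUp_antisymm w j i, map_neg, map_neg]; ring
  have h7 : ∑ m, ∑ l, ((X.conn l).trace * X.D m (X.curlUp w l m)
      + (X.conn m).trace * X.D l (X.curlUp w l m)) = 0 := by
    simp only [Finset.sum_add_distrib]
    nth_rewrite 2 [Finset.sum_comm]
    rw [← Finset.sum_add_distrib]
    refine Finset.sum_eq_zero fun i _ => ?_
    rw [← Finset.sum_add_distrib]
    refine Finset.sum_eq_zero fun j _ => ?_
    rw [X.curlUp_antisymm w j i, map_neg]; ring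
  have h8 := congrArg₂ (· + ·) h6 (congrArg₂ (· + ·) h7 h5)
  simp only [← Finset.sum_add_distrib, add_zero] at h8
  rw [← h8]
  refine Finset.sum_congr rfl fun m _ => Finset.sum_congr rfl fun l _ => ?_
  simp only [map_add, Derivation.leibniz, smul_eq_mul]
  ring

/-- The product `Q_μ{}^λ Q_{νλ}`. -/
def curlProd (w : Fin 4 → R) : Matrix (Fin 4) (Fin 4) R := X.curl w * X.h * (X.curl w)ᵀ

/-- Four times the divergence of the Maxwell stress tensor `F_μ{}^λ F_{νλ} - (1/4) g_{μν} F²`: by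
`dF = 0`, only the contraction of `F` with its own divergence survives. -/
theorem diver2_curlProd (w : Fin 4 → R) (ν : Fin 4) :
    4 * X.diver2 (X.curlProd w) ν - X.D ν (X.tr (X.curlProd w))
      = 4 * X.ip (X.diver2 (X.curl w)) (X.curl w ν) := by
  set F := X.curl w with hF
  have e1 : X.diver2 (X.curlProd w) ν = X.ip (X.diver2 F) (F ν)
      + ∑ l, ∑ j, X.curlUp w l j * X.cov2 l F ν j := by
    have a1 : X.diver2 (X.curlProd w) ν = ∑ l, (X.h * X.cov2 l (X.curlProd w)) l ν := by
      simp only [diver2, mul_apply]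
    have a2 : ∀ l, X.h * X.cov2 l (X.curlProd w)
        = X.h * X.cov2 l F * (X.h * Fᵀ) + X.curlUp w * (X.cov2 l F)ᵀ := fun l => by
      rw [curlProd, cov2_mul_h_mul, cov2_transpose, curlUp]; noncomm_ring
    rw [a1]
    simp only [a2, Matrix.add_apply, Finset.sum_add_distrib]
    congr 1
    simp only [mul_apply (M := X.h * X.cov2 _ F)]
    rw [Finset.sum_comm]
    simp only [← Finset.sum_mul, ip]
    refine Finset.sum_congr rfl fun k _ => ?_
    rw [mul_apply, Finset.mul_sum]
    exact Finset.sum_congr rfl fun j _ => by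
      simp only [diver2, mul_apply, transpose_apply]; ring
  have e2 : X.D ν (X.tr (X.curlProd w)) = 2 * ∑ l, ∑ j, X.curlUp w l j * X.cov2 ν F l j := by
    have b1 : ∑ l, ∑ j, X.curlUp w l j * X.cov2 ν F l j
        = (X.curlUp w * (X.cov2 ν F)ᵀ).trace := by
      simp only [Matrix.trace, diag_apply, mul_apply, transpose_apply]
    have b2 : (X.h * (X.cov2 ν F * X.h * Fᵀ)).trace = (X.curlUp w * (X.cov2 ν F)ᵀ).trace := by
      rw [← trace_transpose, curlUp, ← hF]
      simp only [transpose_mul, transpose_transpose, X.h_symm]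
      rw [trace_mul_comm]
      simp only [mul_assoc]
    have b3 : (X.h * (F * X.h * (X.cov2 ν F)ᵀ)).trace
        = (X.curlUp w * (X.cov2 ν F)ᵀ).trace := by
      rw [curlUp, ← hF]; simp only [mul_assoc]
    rw [D_tr, tr_eq_trace, curlProd, cov2_mul_h_mul, cov2_transpose, mul_add, trace_add, b2, b3,
      b1]
    ring
  -- By the cyclic identity `2 ∇_l F_{νj} - ∇_ν F_{lj} = ∇_l F_{νj} + ∇_j F_{νl}`, which is
  -- symmetric in `l`, `j`.
  have e3 := sum_antisymm_mul_symm (S := X.curlUp w)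
    (X := fun l j => 2 * X.cov2 l F ν j - X.cov2 ν F l j) (X.curlUp_antisymm w) (fun l j => by
      linear_combination 2 * X.cov2_curl_cyclic w l ν j - 2 * X.cov2_curl_antisymm w j ν l
        - X.cov2_curl_antisymm w ν j l)
  have e4 : 2 * ∑ l, ∑ j, X.curlUp w l j * X.cov2 l F ν j
      = ∑ l, ∑ j, X.curlUp w l j * X.cov2 ν F l j := by
    rw [← sub_eq_zero, ← e3, Finset.mul_sum, ← Finset.sum_sub_distrib]
    refine Finset.sum_congr rfl fun l _ => ?_
    rw [Finset.mul_sum, ← Finset.sum_sub_distrib]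
    exact Finset.sum_congr rfl fun j _ => by ring
  rw [e1, e2]
  linear_combination 2 * e4

end LeviCivita

end WeylGravity

end

/-! ### Trace and divergence of the stress-energy tensor on solutions. -/

noncomputable section

namespace WeylGravity

namespace LeviCivita

open Matrix

variable {R : Type*} [CommRing R] [Algebra ℝ R] (X : LeviCivita R)

/-- A real constant as an element of the function ring. -/
local notation "κ" => algebraMap ℝ R

/-- The stress-energy tensor that the Einstein equation assigns to the fields. -/
def stress (om lam b : ℝ) (A : Fin 4 → R) (f : R) : Matrix (Fin 4) (Fin 4) R :=
  f ^ 2 • (X.ric - (κ (1 / 2) * X.tr X.ric) • X.g)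
    - (X.cov1 (X.grad (f ^ 2)) - X.tr (X.cov1 (X.grad (f ^ 2))) • X.g)
    + κ om • (vecMulVec (X.grad f) (X.grad f)
        - (κ (1 / 2) * X.ip (X.grad f) (X.grad f)) • X.g)
    + (κ ((om - 6) / 4) * f ^ 2) • (vecMulVec A A - (κ (1 / 2) * X.ip A A) • X.g)
    - κ ((om - 6) / 4) • (vecMulVec (X.grad (f ^ 2)) A + vecMulVec A (X.grad (f ^ 2))
        - X.ip (X.grad (f ^ 2)) A • X.g)
    - κ b • (X.curlProd A - (κ (1 / 4) * X.tr (X.curlProd A)) • X.g)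
    + (κ (lam / 8) * f ^ 4) • X.g

variable {om lam b : ℝ} {A : Fin 4 → R} {f : R}

/-- The left side of the Proca equation has identically zero divergence, so its source is conserved.
Keeping the factor `(ω - 6)/4` avoids a separate case `ω = 6`. -/
theorem diver1_proca
    (hP : ∀ ν, κ b * X.diver2 (X.curl A) ν = κ ((6 - om) / 4) * (f ^ 2 * A ν - X.D ν (f ^ 2))) :
    κ ((om - 6) / 4) * (X.ip (X.grad (f ^ 2)) A + f ^ 2 * X.diver1 A
      - X.tr (X.cov1 (X.grad (f ^ 2)))) = 0 := by
  have hgrad : ∀ c : ℝ, X.grad (κ c) = 0 := fun c => by ext μ; simp [grad]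
  have hip : ∀ v : Fin 4 → R, X.ip 0 v = 0 := fun v => by simp [ip]
  have h1 : κ b • X.diver2 (X.curl A)
      = κ ((6 - om) / 4) • (f ^ 2 • A + (-1 : R) • X.grad (f ^ 2)) := by
    ext ν
    simp only [Pi.smul_apply, Pi.add_apply, smul_eq_mul, grad]
    rw [hP]; ring
  have h2 := congrArg X.diver1 h1
  have h3 : X.grad (-1 : R) = 0 := by simpa using hgrad (-1)
  simp only [diver1_smul, diver1_add, diver1_diver2_curl, hgrad, h3, hip] at h2
  have h4 : κ ((6 - om) / 4) = -κ ((om - 6) / 4) := by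
    rw [← map_neg]; congr 1; ring
  rw [h4] at h2
  simp only [diver1] at h2 ⊢
  linear_combination h2

/-- `hS` is the scalar equation times `f²`. The trace is `-hS` plus twice the conserved-source
relation `h0`, which trades `f² ∇_μ A^μ` for the terms `∂f² · A` and `∇²f²`. -/
theorem tr_stress
    (hP : ∀ ν, κ b * X.diver2 (X.curl A) ν = κ ((6 - om) / 4) * (f ^ 2 * A ν - X.D ν (f ^ 2)))
    (hS : f ^ 2 * X.tr X.ric + κ om * X.ip (X.grad f) (X.grad f)
      - κ (om / 2) * X.tr (X.cov1 (X.grad (f ^ 2))) + κ ((om - 6) / 4) * f ^ 2 * X.ip A A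
      + κ ((om - 6) / 2) * f ^ 2 * X.diver1 A - κ (lam / 2) * f ^ 4 = 0) :
    X.tr (X.stress om lam b A f) = 0 := by
  have h0 := X.diver1_proca hP
  have hh : κ (1 / 2) * 2 = 1 := by
    rw [← map_ofNat (algebraMap ℝ R) 2, ← map_mul]; norm_num
  have hq : κ (1 / 4) * 4 = 1 := by
    rw [← map_ofNat (algebraMap ℝ R) 4, ← map_mul]; norm_num
  have e1 : κ ((om - 6) / 2) = 2 * κ ((om - 6) / 4) := by
    rw [← map_ofNat (algebraMap ℝ R) 2, ← map_mul]; congr 1; ring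
  -- The `3` matches the coefficient `4 - 1` of `∇²f²` in the trace; the rest is absorbed by `h0`.
  have e2 : κ (om / 2) = 2 * κ ((om - 6) / 4) + 3 := by
    rw [← map_ofNat (algebraMap ℝ R) 2, ← map_ofNat (algebraMap ℝ R) 3, ← map_mul, ← map_add]
    congr 1; ring
  have e3 : κ (lam / 2) = 4 * κ (lam / 8) := by
    rw [← map_ofNat (algebraMap ℝ R) 4, ← map_mul]; congr 1; ring
  rw [e1, e2, e3] at hS
  simp only [stress, tr_add, tr_sub, tr_smul, tr_g, tr_vecMulVec, X.ip_comm A (X.grad (f ^ 2))]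
  linear_combination -hS + 2 * h0 - 2 * (f ^ 2 * X.tr X.ric) * hh
    - 2 * (κ om * X.ip (X.grad f) (X.grad f)) * hh
    - 2 * (κ ((om - 6) / 4) * f ^ 2 * X.ip A A) * hh + κ b * X.tr (X.curlProd A) * hq

/-- Noether's identity in explicit form: the divergence combines the scalar equation times `∂_ν f`,
the Proca equation contracted with the field strength, and the divergence of the Proca equation
times `A_ν`. -/
theorem diver2_stress
    (hP : ∀ ν, κ b * X.diver2 (X.curl A) ν = κ ((6 - om) / 4) * (f ^ 2 * A ν - X.D ν (f ^ 2)))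
    (hS : f ^ 2 * X.tr X.ric + κ om * X.ip (X.grad f) (X.grad f)
      - κ (om / 2) * X.tr (X.cov1 (X.grad (f ^ 2))) + κ ((om - 6) / 4) * f ^ 2 * X.ip A A
      + κ ((om - 6) / 2) * f ^ 2 * X.diver1 A - κ (lam / 2) * f ^ 4 = 0)
    (hf : IsUnit f) (ν : Fin 4) :
    X.diver2 (X.stress om lam b A f) ν = 0 := by
  have h0 := X.diver1_proca hP
  have hh : κ (1 / 2) * 2 = 1 := by
    rw [← map_ofNat (algebraMap ℝ R) 2, ← map_mul]; norm_num
  have hq : κ (1 / 4) * 4 = 1 := by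
    rw [← map_ofNat (algebraMap ℝ R) 4, ← map_mul]; norm_num
  have e1 : κ ((om - 6) / 2) = 2 * κ ((om - 6) / 4) := by
    rw [← map_ofNat (algebraMap ℝ R) 2, ← map_mul]; congr 1; ring
  have e2 : κ om = 2 * κ (om / 2) := by
    rw [← map_ofNat (algebraMap ℝ R) 2, ← map_mul]; congr 1; ring
  have e3 : κ (lam / 2) = 4 * κ (lam / 8) := by
    rw [← map_ofNat (algebraMap ℝ R) 4, ← map_mul]; congr 1; ring
  have e4 : κ ((6 - om) / 4) = -κ ((om - 6) / 4) := by
    rw [← map_neg]; congr 1; ring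
  have hgrad : ∀ c : ℝ, X.grad (κ c) = 0 := fun c => by ext μ; simp [grad]
  have hip0 : ∀ v : Fin 4 → R, X.ip 0 v = 0 := fun v => by simp [ip]
  have hDk : ∀ (c : ℝ) (s : R), X.D ν (κ c * s) = κ c * X.D ν s := fun c s => by simp
  have hF : X.grad (f ^ 2) = (2 * f) • X.grad f := by
    ext μ; simp only [grad, pow_two, Derivation.leibniz, smul_eq_mul, Pi.smul_apply]; ring
  have hF2 : X.D ν (f ^ 4) = 2 * f ^ 2 * X.D ν (f ^ 2) := by
    rw [show f ^ 4 = f ^ 2 * f ^ 2 by ring]; simp only [Derivation.leibniz, smul_eq_mul]; ring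
  have hbox : X.tr (X.cov1 (X.grad (f ^ 2)))
      = 2 * f * X.diver1 (X.grad f) + 2 * X.ip (X.grad f) (X.grad f) := by
    have : X.grad (2 * f) = (2 : R) • X.grad f := by
      rw [two_mul, two_smul]; ext μ; simp [grad]
    rw [hF]
    change X.diver1 _ = _
    rw [diver1_smul, this, ip_comm, ip_smul]; ring
  have hDF : X.D ν (f ^ 2) = 2 * f * X.D ν f := congrFun hF ν
  have hric := X.diver2_ric ν
  have hhess := X.diver2_hess (f ^ 2) ν
  have hcp := X.diver2_curlProd A ν
  -- Swapping the indices of `∇_l A_ν` produces the field strength; these terms are what `hcurl`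
  -- cancels.
  have hgg : ∀ u : Fin 4 → R, X.ip u (fun l => X.cov1 A l ν) - X.ip u (X.cov1 A ν)
      = - X.ip u (X.curl A ν) := fun u => by
    rw [← ip_sub, ← neg_one_mul, ← ip_smul]
    congr 1; ext l
    have := X.cov1_sub_cov1 A l ν
    have h2 := X.curl_antisymm A l ν
    simp only [Pi.sub_apply, Pi.smul_apply, smul_eq_mul]
    linear_combination this + h2
  have hgs : ∀ (a : R), (fun l => X.cov1 (X.grad a) l ν) = X.cov1 (X.grad a) ν := fun a => by
    ext l; exact X.cov1_grad_symm a l ν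
  have hcurl : κ b * X.ip (X.diver2 (X.curl A)) (X.curl A ν)
      = κ ((6 - om) / 4) * (f ^ 2 * X.ip A (X.curl A ν)
        - X.ip (X.grad (f ^ 2)) (X.curl A ν)) := by
    rw [X.ip_comm, X.ip_comm A, X.ip_comm (X.grad (f ^ 2)), ← ip_smul, ← ip_smul, ← ip_sub,
      ← ip_smul]
    congr 1; ext l
    exact hP l
  have hvAA : X.ip (X.grad (f ^ 2)) (fun μ => vecMulVec A A μ ν)
      = X.ip (X.grad (f ^ 2)) A * A ν := by
    simp only [vecMulVec_apply, ip, Finset.sum_mul, mul_assoc]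
  have hsub : ∀ B C : Matrix (Fin 4) (Fin 4) R, X.ip (X.grad (f ^ 2)) (fun μ => (B - C) μ ν)
      = X.ip (X.grad (f ^ 2)) (fun μ => B μ ν) - X.ip (X.grad (f ^ 2)) (fun μ => C μ ν) :=
    fun B C => X.ip_sub _ _ _
  have hsm : ∀ s : R, X.ip (X.grad (f ^ 2)) (fun μ => (s • X.g) μ ν) = s * X.D ν (f ^ 2) :=
    fun s => by
      rw [show X.D ν (f ^ 2) = X.grad (f ^ 2) ν from rfl, ← X.ip_g (X.grad (f ^ 2)) ν, ← ip_smul]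
      rfl
  -- The divergence contains `f ∂_ν f` times the scalar equation, whereas `hS` carries `f²`; the
  -- extra factor `f` makes up the difference and is cancelled as a unit.
  have main : f * X.diver2 (X.stress om lam b A f) ν = 0 := by
    have hc : ∀ (c : ℝ) (B : Matrix (Fin 4) (Fin 4) R),
        X.diver2 (κ c • B) ν = κ c * X.diver2 B ν := fun c B => by
      rw [diver2_smul, hgrad, hip0, zero_add]
    rw [stress, diver2_add, diver2_sub, diver2_sub, diver2_add, diver2_add, diver2_sub,
      diver2_smul, hsub, hsm, diver2_sub, diver2_smul_g, diver2_sub, diver2_smul_g, hc om,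
      diver2_sub, diver2_smul_g, diver2_vecMulVec, mul_smul, hc, diver2_smul, hsub, hsm,
      diver2_sub, diver2_smul_g, diver2_vecMulVec, hc, diver2_sub, diver2_smul_g, diver2_add,
      diver2_vecMulVec, diver2_vecMulVec, hc, diver2_sub, diver2_smul_g, diver2_smul_g, hvAA,
      hgs, hgs]
    simp only [hDk, D_ip, hF2]
    rw [show X.grad f ν = X.D ν f from rfl, show X.grad (f ^ 2) ν = X.D ν (f ^ 2) from rfl, hDF,
      show X.diver1 (X.grad (f ^ 2)) = X.tr (X.cov1 (X.grad (f ^ 2))) from rfl]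
    rw [e1, e3, e2] at hS
    rw [e4] at hcurl
    rw [e2]
    linear_combination -X.D ν f * hS - X.D ν f * κ (om / 2) * hbox
      - f ^ 2 * X.D ν f * (X.tr X.ric + κ ((om - 6) / 4) * X.ip A A) * hh
      + κ (1 / 2) * f ^ 3 * hric - f ^ 3 * X.diver2 X.ric ν * hh - f * hhess
      - 2 * κ (om / 2) * f * X.ip (X.grad f) (X.cov1 (X.grad f) ν) * hh
      - κ ((om - 6) / 4) * f ^ 3 * X.ip A (X.cov1 A ν) * hh
      + κ ((om - 6) / 4) * f ^ 3 * hgg A - κ ((om - 6) / 4) * f * hgg (X.grad (f ^ 2))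
      + A ν * f * h0 + κ b * f * X.diver2 (X.curlProd A) ν * hq - κ b * f * κ (1 / 4) * hcp
      - κ b * f * X.ip (X.diver2 (X.curl A)) (X.curl A ν) * hq - f * hcurl
  exact (hf.mul_right_eq_zero).mp main

end LeviCivita

end WeylGravity

end

/-! ### Existence of the Levi-Civita connection, and the ring of smooth functions on an open set. -/

noncomputable section

namespace WeylGravity

open Matrix

/-- The Levi-Civita connection of a metric over a ring with commuting derivations. -/
def LeviCivita.ofMetric {R : Type*} [CommRing R] [Algebra ℝ R] (D : Fin 4 → Derivation ℝ R R)
    (D_comm : ∀ i j a, D i (D j a) = D j (D i a)) (g : Matrix (Fin 4) (Fin 4) R)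
    (g_symm : gᵀ = g) (hdet : IsUnit g.det) : LeviCivita R where
  D := D
  D_comm := D_comm
  g := g
  h := g⁻¹
  conn μ α ν := algebraMap ℝ R (1 / 2) *
    ∑ l, g⁻¹ α l * (D ν (g μ l) + D μ (g ν l) - D l (g μ ν))
  g_symm := g_symm
  h_symm := by rw [transpose_nonsing_inv, g_symm]
  h_mul_g := nonsing_inv_mul _ hdet
  torsion μ α ν := by
    have hs : ∀ i j, g i j = g j i := fun i j => congrFun₂ g_symm j i
    congr 1
    exact Finset.sum_congr rfl fun l _ => by rw [hs μ ν]; ring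
  D_g l := by
    have hs : ∀ i j, g i j = g j i := fun i j => congrFun₂ g_symm j i
    have hh : algebraMap ℝ R (1 / 2) * 2 = 1 := by
      rw [← map_ofNat (algebraMap ℝ R) 2, ← map_mul]; norm_num
    -- Lowering the upper index of `Γ` with `g` gives the Christoffel symbols of the first kind; two
    -- of them add up to `∂_l g_{ij}`.
    have key : ∀ (b : Fin 4 → R) (σ : Fin 4),
        ∑ α, g σ α * (algebraMap ℝ R (1 / 2) * ∑ k, g⁻¹ α k * b k)
          = algebraMap ℝ R (1 / 2) * b σ := fun b σ => by
      have := congrFun (mulVec_mulVec b g g⁻¹) σ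
      rw [mul_nonsing_inv _ hdet, one_mulVec] at this
      rw [← this]
      simp only [mulVec, dotProduct, Finset.mul_sum]
      exact Finset.sum_congr rfl fun _ _ => Finset.sum_congr rfl fun _ _ => by ring
    ext i j
    have h1 := key (fun k => D i (g l k) + D l (g i k) - D k (g l i)) j
    have h2 := key (fun k => D j (g l k) + D l (g j k) - D k (g l j)) i
    have h3 : ∀ c : Fin 4 → R, ∑ α, c α * g α j = ∑ α, g j α * c α := fun c =>
      Finset.sum_congr rfl fun α _ => by rw [hs α j, mul_comm]
    rw [map_apply, Matrix.add_apply]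
    refine Eq.trans ?_ (congrArg₂ (· + ·) ((h3 _).trans h1) h2).symm
    simp only [hs j i, hs l i, hs l j]
    linear_combination -(D l (g i j)) * hh

/-- The smooth functions on a set `U ⊆ ℝ⁴`. -/
def smoothOn (U : Set E4) : Subalgebra ℝ (U → ℝ) where
  carrier := {a | ∃ F : E4 → ℝ, ContDiffOn ℝ ∞ F U ∧ ∀ y : U, F y = a y}
  mul_mem' := by
    rintro _ _ ⟨F, hF, hFa⟩ ⟨K, hK, hKb⟩
    exact ⟨F * K, hF.mul hK, fun y => congrArg₂ (· * ·) (hFa y) (hKb y)⟩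
  add_mem' := by
    rintro _ _ ⟨F, hF, hFa⟩ ⟨K, hK, hKb⟩
    exact ⟨F + K, hF.add hK, fun y => congrArg₂ (· + ·) (hFa y) (hKb y)⟩
  algebraMap_mem' c := ⟨fun _ => c, contDiffOn_const, fun _ => rfl⟩

namespace smoothOn

variable {U : Set E4}

/-- Evaluation at a point. -/
def ev (y : U) : smoothOn U →ₐ[ℝ] ℝ :=
  (Pi.evalAlgHom ℝ (fun _ : U => ℝ) y).comp (smoothOn U).val

theorem ext_ev {a b : smoothOn U} (h : ∀ y, ev y a = ev y b) : a = b := Subtype.ext (funext h)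

/-- The restriction to `U` of a function that is smooth on `U`. -/
def restrict (F : E4 → ℝ) (hF : ContDiffOn ℝ ∞ F U) : smoothOn U :=
  ⟨fun y => F y, F, hF, fun _ => rfl⟩

theorem ev_restrict (F : E4 → ℝ) (hF : ContDiffOn ℝ ∞ F U) (y : U) :
    ev y (restrict F hF) = F y := rfl

/-- A function on `ℝ⁴` with the given restriction to `U`. -/
def rep (a : smoothOn U) : E4 → ℝ := a.2.choose

theorem contDiffOn_rep (a : smoothOn U) : ContDiffOn ℝ ∞ (rep a) U := a.2.choose_spec.1

theorem rep_apply (a : smoothOn U) (y : U) : rep a y = ev y a := a.2.choose_spec.2 y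

theorem isUnit_of_ev_ne_zero (a : smoothOn U) (h : ∀ y, ev y a ≠ 0) : IsUnit a :=
  IsUnit.of_mul_eq_one (restrict (fun y => (rep a y)⁻¹) ((contDiffOn_rep a).inv fun y hy => by
      rw [rep_apply a ⟨y, hy⟩]; exact h _))
    (ext_ev fun y => by
      rw [map_mul, map_one, ev_restrict, rep_apply]; exact mul_inv_cancel₀ (h y))

theorem contDiffAt_rep (hU : IsOpen U) (a : smoothOn U) (y : U) : ContDiffAt ℝ ∞ (rep a) y :=
  (contDiffOn_rep a).contDiffAt (hU.mem_nhds y.2)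

theorem differentiableAt_rep (hU : IsOpen U) (a : smoothOn U) (y : U) :
    DifferentiableAt ℝ (rep a) y :=
  (contDiffAt_rep hU a y).differentiableAt (by simp)

theorem contDiffOn_pd (hU : IsOpen U) {F : E4 → ℝ} (hF : ContDiffOn ℝ ∞ F U) (μ : Fin 4) :
    ContDiffOn ℝ ∞ (pd μ F) U :=
  ((ContDiffOn.fderiv_of_isOpen hF hU (m := ∞) (by simp)).clm_apply contDiffOn_const)

/-- Makes derivatives on the open set `U` independent of the arbitrary extension chosen by `rep`. -/
theorem pd_congr (hU : IsOpen U) {F K : E4 → ℝ} (h : ∀ y : U, F y = K y) (μ : Fin 4) (y : U) :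
    pd μ F y = pd μ K y := by
  rw [pd, pd, Filter.EventuallyEq.fderiv_eq
    (Filter.eventually_of_mem (hU.mem_nhds y.2) fun z hz => h ⟨z, hz⟩)]

/-- The partial derivative as a derivation. -/
def D (hU : IsOpen U) (μ : Fin 4) : Derivation ℝ (smoothOn U) (smoothOn U) :=
  Derivation.mk'
    { toFun := fun a => restrict (pd μ (rep a)) (contDiffOn_pd hU (contDiffOn_rep a) μ)
      map_add' := fun a b => ext_ev fun y => by
        rw [map_add, ev_restrict, ev_restrict, ev_restrict, pd_congr hU (K := rep a + rep b)
          (fun z => by rw [Pi.add_apply]; simp only [rep_apply, map_add])]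
        exact congrArg (· (EuclideanSpace.single μ (1 : ℝ)))
          (fderiv_add (differentiableAt_rep hU a y) (differentiableAt_rep hU b y))
      map_smul' := fun c a => ext_ev fun y => by
        rw [map_smul, ev_restrict, ev_restrict, pd_congr hU (K := c • rep a)
          (fun z => by rw [Pi.smul_apply]; simp only [rep_apply, map_smul])]
        exact congrArg (· (EuclideanSpace.single μ (1 : ℝ)))
          (fderiv_const_smul (differentiableAt_rep hU a y) c) }
    fun a b => ext_ev fun y => by
      rw [map_add, smul_eq_mul, smul_eq_mul, map_mul (ev y) a, map_mul (ev y) b]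
      change pd μ (rep (a * b)) y = ev y a * pd μ (rep b) y + ev y b * pd μ (rep a) y
      rw [pd_congr hU (K := rep a * rep b)
        (fun z => by rw [Pi.mul_apply]; simp only [rep_apply, map_mul]), ← rep_apply, ← rep_apply]
      exact congrArg (· (EuclideanSpace.single μ (1 : ℝ)))
        (fderiv_mul (differentiableAt_rep hU a y) (differentiableAt_rep hU b y))

theorem pd_eq_ev_D (hU : IsOpen U) {F : E4 → ℝ} {a : smoothOn U} (h : ∀ y : U, F y = ev y a)
    (μ : Fin 4) (y : U) : pd μ F y = ev y (D hU μ a) :=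
  pd_congr hU (fun z => (h z).trans (rep_apply a z).symm) μ y

theorem D_comm (hU : IsOpen U) (i j : Fin 4) (a : smoothOn U) :
    D hU i (D hU j a) = D hU j (D hU i a) := by
  refine ext_ev fun y => ?_
  have hd : ∀ i j, ev y (D hU i (D hU j a)) = fderiv ℝ (fderiv ℝ (rep a)) y
      (EuclideanSpace.single i (1 : ℝ)) (EuclideanSpace.single j (1 : ℝ)) := fun i j => by
    rw [← pd_eq_ev_D hU (F := pd j (rep a)) (fun _ => rfl) i y]
    have hda : DifferentiableAt ℝ (fderiv ℝ (rep a)) y :=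
      ((contDiffAt_rep hU a y).fderiv_right (m := ∞) (by simp)).differentiableAt (by simp)
    change fderiv ℝ (fun z => fderiv ℝ (rep a) z _) y _ = _
    rw [fderiv_clm_apply hda (differentiableAt_const _)]
    simp
  rw [hd, hd]
  exact (ContDiffAt.isSymmSndFDerivAt (contDiffAt_rep hU a y)
    (by rw [minSmoothness_of_isRCLikeNormedField]; exact WithTop.coe_le_coe.2 le_top)).eq _ _

/-- The components of a metric on `U`. -/
def metric (G : E4 → Matrix (Fin 4) (Fin 4) ℝ)
    (hG : ∀ μ ν, ContDiffOn ℝ ∞ (fun y => G y μ ν) U) : Matrix (Fin 4) (Fin 4) (smoothOn U) :=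
  fun μ ν => restrict _ (hG μ ν)

variable {G : E4 → Matrix (Fin 4) (Fin 4) ℝ} {hG : ∀ μ ν, ContDiffOn ℝ ∞ (fun y => G y μ ν) U}

theorem map_ev_metric (y : U) : (metric G hG).map (ev y) = G y := rfl

theorem isUnit_det_metric (hdet : ∀ y ∈ U, (G y).det ≠ 0) : IsUnit (metric G hG).det :=
  isUnit_of_ev_ne_zero _ fun y => by
    rw [AlgHom.map_det, AlgHom.mapMatrix_apply, map_ev_metric]; exact hdet y y.2

theorem metric_transpose (hs : ∀ y ∈ U, (G y)ᵀ = G y) : (metric G hG)ᵀ = metric G hG :=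
  Matrix.ext fun μ ν => ext_ev fun y => congrFun₂ (hs y y.2) μ ν

end smoothOn

end WeylGravity

end

/-! ### Translation between coordinate formulas and the algebraic calculus. -/

noncomputable section

namespace WeylGravity

open Matrix smoothOn

variable {U : Set E4}

/-- `X` is the Levi-Civita calculus of the metric with components `G` on `U`. -/
structure Represents (hU : IsOpen U) (G : E4 → Matrix (Fin 4) (Fin 4) ℝ)
    (X : LeviCivita (smoothOn U)) : Prop where
  D_eq : X.D = smoothOn.D hU
  g_eq : ∀ (y : U) (μ ν), G y μ ν = ev y (X.g μ ν)
  ginv_eq : ∀ (y : U) (μ ν), ginv G μ ν y = ev y (X.h μ ν)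
  christoffel_eq : ∀ (y : U) (α μ ν), christoffel G α μ ν y = ev y (X.conn μ α ν)

theorem exists_represents (hU : IsOpen U) {G : E4 → Matrix (Fin 4) (Fin 4) ℝ}
    (hG : ∀ μ ν, ContDiffOn ℝ ∞ (fun y => G y μ ν) U) (hs : ∀ y ∈ U, (G y)ᵀ = G y)
    (hdet : ∀ y ∈ U, (G y).det ≠ 0) : ∃ X, Represents hU G X := by
  let X : LeviCivita (smoothOn U) := LeviCivita.ofMetric (smoothOn.D hU) (smoothOn.D_comm hU)
    (metric G hG) (metric_transpose hs) (isUnit_det_metric hdet)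
  have hg : ∀ (y : U) (μ ν), G y μ ν = ev y (X.g μ ν) := fun y μ ν =>
    (congrFun₂ (map_ev_metric (hG := hG) y) μ ν).symm
  have hh : ∀ (y : U) (μ ν), ginv G μ ν y = ev y (X.h μ ν) := fun y μ ν => by
    have h1 : X.h.map (ev y) * G y = 1 := by
      rw [← map_ev_metric (hG := hG) y, ← AlgHom.mapMatrix_apply, ← AlgHom.mapMatrix_apply,
        ← map_mul]
      change (ev y).mapMatrix (X.h * X.g) = 1
      rw [X.h_mul_g, map_one]
    rw [ginv, inv_eq_left_inv h1]; rfl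
  refine ⟨X, rfl, hg, hh, fun y α μ ν => ?_⟩
  have hpd : ∀ l i j, pd l (fun z => G z i j) y = ev y (smoothOn.D hU l (X.g i j)) := fun l i j =>
    pd_eq_ev_D hU (fun z => hg z i j) l y
  change _ = ev y (algebraMap ℝ (smoothOn U) (1 / 2) * ∑ l, X.h α l *
    (smoothOn.D hU ν (X.g μ l) + smoothOn.D hU μ (X.g ν l) - smoothOn.D hU l (X.g μ ν)))
  simp only [christoffel, hh y, hpd, map_mul, map_sum, map_add, map_sub, AlgHom.commutes]
  rfl

namespace Represents

variable {hU : IsOpen U} {G : E4 → Matrix (Fin 4) (Fin 4) ℝ} {X : LeviCivita (smoothOn U)}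
  (r : Represents hU G X)
include r

theorem pd_eq {F : E4 → ℝ} {a : smoothOn U} (h : ∀ z : U, F z = ev z a) (μ : Fin 4) (y : U) : pd μ F y = ev y (X.D μ a) := by
  rw [r.D_eq]; exact pd_eq_ev_D hU h μ y

variable (y : U)

theorem riemann_eq (α σ μ ν : Fin 4) : riemann G α σ μ ν y = ev y (X.riem μ ν α σ) := by
  simp only [riemann, LeviCivita.riem, Matrix.sub_apply, Matrix.add_apply, map_apply, mul_apply,
    map_sub, map_add, map_sum, map_mul, r.christoffel_eq y,
    r.pd_eq (fun z => r.christoffel_eq z _ _ _) _ y, Finset.sum_sub_distrib]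
  ring

theorem ricci_eq (μ ν : Fin 4) : ricci G μ ν y = ev y (X.ric μ ν) := by
  simp only [ricci, LeviCivita.ric, r.riemann_eq y, map_sum]

theorem sum_ginv_mul_eq {C : Fin 4 → Fin 4 → ℝ} {B' : Matrix (Fin 4) (Fin 4) (smoothOn U)}
    (hB : ∀ μ ν, C μ ν = ev y (B' μ ν)) :
    ∑ μ, ∑ ν, ginv G μ ν y * C μ ν = ev y (X.tr B') := by
  simp only [LeviCivita.tr, r.ginv_eq y, hB, map_sum, map_mul]

theorem scalarCurv_eq : scalarCurv G y = ev y (X.tr X.ric) :=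
  r.sum_ginv_mul_eq y fun _ _ => r.ricci_eq y _ _

theorem dot_eq {a b : Fin 4 → ℝ} {a' b' : Fin 4 → smoothOn U} (ha : ∀ μ, a μ = ev y (a' μ))
    (hb : ∀ μ, b μ = ev y (b' μ)) : dot G a b y = ev y (X.ip a' b') := by
  simp only [dot, LeviCivita.ip, r.ginv_eq y, ha, hb, map_sum, map_mul]

theorem covD1_eq {A : E4 → Fin 4 → ℝ} {A' : Fin 4 → smoothOn U}
    (hA : ∀ z : U, ∀ μ, A z μ = ev z (A' μ)) (μ ν : Fin 4) :
    covD1 G A μ ν y = ev y (X.cov1 A' μ ν) := by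
  have hp : ∀ i j, pd i (fun z => A z j) y = ev y (X.D i (A' j)) := fun i j =>
    r.pd_eq (fun z => hA z j) i y
  simp only [covD1, LeviCivita.cov1, hp, hA y,
    r.christoffel_eq y, map_sub, map_sum, map_mul]

theorem div1_eq {A : E4 → Fin 4 → ℝ} {A' : Fin 4 → smoothOn U}
    (hA : ∀ z : U, ∀ μ, A z μ = ev z (A' μ)) : div1 G A y = ev y (X.diver1 A') :=
  r.sum_ginv_mul_eq y fun _ _ => r.covD1_eq y hA _ _

theorem div2_eq {B : E4 → Matrix (Fin 4) (Fin 4) ℝ} {B' : Matrix (Fin 4) (Fin 4) (smoothOn U)}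
    (hB : ∀ z : U, ∀ μ ν, B z μ ν = ev z (B' μ ν)) (ν : Fin 4) :
    div2 G B ν y = ev y (X.diver2 B' ν) := by
  have hp : ∀ l i j, pd l (fun z => B z i j) y = ev y (X.D l (B' i j)) := fun l i j =>
    r.pd_eq (fun z => hB z i j) l y
  simp only [div2, covD2, LeviCivita.diver2, LeviCivita.cov2_apply,
    hp, hB y, r.ginv_eq y,
    r.christoffel_eq y, map_sub, map_sum, map_mul, mul_comm (ev y (B' _ _))]

theorem hess_eq {F : E4 → ℝ} {a : smoothOn U} (h : ∀ z : U, F z = ev z a) (μ ν : Fin 4) :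
    hess G F μ ν y = ev y (X.cov1 (X.grad a) μ ν) :=
  r.covD1_eq y (fun z l => r.pd_eq h l z) μ ν

theorem box_eq {F : E4 → ℝ} {a : smoothOn U} (h : ∀ z : U, F z = ev z a) :
    box G F y = ev y (X.tr (X.cov1 (X.grad a))) :=
  r.sum_ginv_mul_eq y fun _ _ => r.hess_eq y h _ _

theorem fieldStrength_eq {A : E4 → Fin 4 → ℝ} {A' : Fin 4 → smoothOn U}
    (hA : ∀ z : U, ∀ μ, A z μ = ev z (A' μ)) (μ ν : Fin 4) :
    fieldStrength A y μ ν = ev y (X.curl A' μ ν) := by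
  have hp : ∀ i j, pd i (fun z => A z j) y = ev y (X.D i (A' j)) := fun i j =>
    r.pd_eq (fun z => hA z j) i y
  simp only [fieldStrength, LeviCivita.curl, hp, map_sub]

theorem fieldStrengthProd_eq {A : E4 → Fin 4 → ℝ} {A' : Fin 4 → smoothOn U}
    (hA : ∀ z : U, ∀ μ, A z μ = ev z (A' μ)) (μ ν : Fin 4) :
    fieldStrengthProd G A μ ν y = ev y (X.curlProd A' μ ν) := by
  simp only [fieldStrengthProd, LeviCivita.curlProd, mul_apply, transpose_apply, map_sum, map_mul,
    r.fieldStrength_eq y hA, r.ginv_eq y, Finset.sum_mul]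
  rw [Finset.sum_comm]
  exact Finset.sum_congr rfl fun _ _ => Finset.sum_congr rfl fun _ _ => by ring

theorem fieldStrengthSq_eq {A : E4 → Fin 4 → ℝ} {A' : Fin 4 → smoothOn U}
    (hA : ∀ z : U, ∀ μ, A z μ = ev z (A' μ)) :
    fieldStrengthSq G A y = ev y (X.tr (X.curlProd A')) :=
  r.sum_ginv_mul_eq y fun _ _ => r.fieldStrengthProd_eq y hA _ _

/-- Multiplying by `f²` clears the denominators, so `stress` is polynomial in `f`; its parameter `b`
is `β²`. -/
theorem einsteinLHS_eq {A : E4 → Fin 4 → ℝ} {A' : Fin 4 → smoothOn U}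
    (hA : ∀ z : U, ∀ μ, A z μ = ev z (A' μ)) {f : E4 → ℝ} {f' : smoothOn U}
    (hf : ∀ z : U, f z = ev z f') (hf0 : f y ≠ 0) (om lam β : ℝ) (μ ν : Fin 4) :
    f y ^ 2 * (einsteinLHS om β G A f μ ν y + lam / 8 * f y ^ 2 * G y μ ν)
      = ev y (X.stress om lam (β ^ 2) A' f' μ ν) := by
  have hF : ∀ z : U, (fun z => f z ^ 2) z = ev z (f' ^ 2) := fun z => by
    rw [map_pow, ← hf z]
  have hpf : ∀ l, pd l f y = ev y (X.grad f' l) := fun l => r.pd_eq hf l y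
  have hpF : ∀ l, pd l (fun z => f z ^ 2) y = ev y (X.grad (f' ^ 2) l) := fun l => r.pd_eq hF l y
  have hk : ∀ c : ℝ, ev y (algebraMap ℝ (smoothOn U) c) = c := fun c => AlgHom.commutes _ c
  rw [einsteinLHS, einstein, r.ricci_eq y, r.scalarCurv_eq y, r.hess_eq y hF, r.box_eq y hF,
    r.dot_eq y hpf hpf, r.dot_eq y (hA y) (hA y), r.dot_eq y hpF (hA y),
    r.fieldStrengthProd_eq y hA, r.fieldStrengthSq_eq y hA, hpf, hpf, hpF, hpF, hA y, hA y,
    r.g_eq y]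
  simp only [LeviCivita.stress, Matrix.add_apply, Matrix.sub_apply, Matrix.smul_apply,
    vecMulVec_apply, smul_eq_mul, map_add, map_sub, map_mul, map_pow, hk, ← hf y]
  field_simp
  ring

end Represents

/-- In one coordinate system, the field equations imply that the stress-energy tensor is traceless
and conserved. -/
theorem trace_eq_zero_and_div2_eq_zero (hU : IsOpen U) {G : E4 → Matrix (Fin 4) (Fin 4) ℝ}
    (hG : ∀ μ ν, ContDiffOn ℝ ∞ (fun y => G y μ ν) U) (hs : ∀ y ∈ U, (G y)ᵀ = G y)
    (hdet : ∀ y ∈ U, (G y).det ≠ 0) {A : E4 → Fin 4 → ℝ}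
    (hA : ∀ μ, ContDiffOn ℝ ∞ (fun y => A y μ) U) {f : E4 → ℝ} (hf : ContDiffOn ℝ ∞ f U)
    (hf0 : ∀ y, f y ≠ 0) {T : E4 → Matrix (Fin 4) (Fin 4) ℝ} {om lam β : ℝ}
    (hE : ∀ y ∈ U, ∀ μ ν, einsteinLHS om β G A f μ ν y
      = 1 / f y ^ 2 * T y μ ν - lam / 8 * f y ^ 2 * G y μ ν)
    (hP : ∀ y ∈ U, ∀ ν, β ^ 2 * div2 G (fieldStrength A) ν y
      = (6 - om) / 4 * (f y ^ 2 * A y ν - pd ν (fun z => f z ^ 2) y))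
    (hS : ∀ y ∈ U, scalarCurv G y
      + om * dot G (fun l => pd l f y) (fun l => pd l f y) y / f y ^ 2
      - om / 2 * box G (fun z => f z ^ 2) y / f y ^ 2 + (om - 6) / 4 * dot G (A y) (A y) y
      + (om - 6) / 2 * div1 G A y - lam / 2 * f y ^ 2 = 0) {y : E4} (hy : y ∈ U) :
    trace G T y = 0 ∧ ∀ ν, div2 G T ν y = 0 := by
  obtain ⟨X, r⟩ := exists_represents hU hG hs hdet
  set A' : Fin 4 → smoothOn U := fun μ => restrict _ (hA μ)
  set f' : smoothOn U := restrict f hf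
  have hA' : ∀ (z : U) (μ), A z μ = ev z (A' μ) := fun _ _ => rfl
  have hf' : ∀ z : U, f z = ev z f' := fun _ => rfl
  have hF : ∀ z : U, (fun z => f z ^ 2) z = ev z (f' ^ 2) := fun z => by rw [map_pow, ← hf' z]
  have hk : ∀ (z : U) (c : ℝ), ev z (algebraMap ℝ (smoothOn U) c) = c :=
    fun z c => AlgHom.commutes _ c
  have hP' : ∀ ν, algebraMap ℝ _ (β ^ 2) * X.diver2 (X.curl A') ν
      = algebraMap ℝ _ ((6 - om) / 4) * (f' ^ 2 * A' ν - X.D ν (f' ^ 2)) := fun ν =>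
    ext_ev fun z => by
      have := hP z z.2 ν
      rw [r.div2_eq z (r.fieldStrength_eq · hA'), r.pd_eq hF, hA', hf'] at this
      simpa only [map_mul, map_sub, map_pow, hk] using this
  have hS' : f' ^ 2 * X.tr X.ric + algebraMap ℝ _ om * X.ip (X.grad f') (X.grad f')
      - algebraMap ℝ _ (om / 2) * X.tr (X.cov1 (X.grad (f' ^ 2)))
      + algebraMap ℝ _ ((om - 6) / 4) * f' ^ 2 * X.ip A' A'
      + algebraMap ℝ _ ((om - 6) / 2) * f' ^ 2 * X.diver1 A'
      - algebraMap ℝ _ (lam / 2) * f' ^ 4 = 0 := ext_ev fun z => by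
    have h0 := hf0 z
    have h1 := hS z z.2
    have hpf : ∀ l, pd l f z = ev z (X.grad f' l) := fun l => r.pd_eq hf' l z
    rw [r.scalarCurv_eq, r.dot_eq z hpf hpf, r.box_eq z hF, r.dot_eq z (hA' z) (hA' z),
      r.div1_eq z hA'] at h1
    simp only [map_add, map_sub, map_mul, map_pow, hk, ← hf', map_zero]
    field_simp at h1
    linear_combination h1 / 8
  -- The Einstein equation is solved for `T` on all of `U`, which also shows that its components are
  -- smooth there; no regularity of `T` has to be assumed.
  have hT : ∀ (z : U) (μ ν), T z μ ν = ev z (X.stress om lam (β ^ 2) A' f' μ ν) := fun z μ ν => by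
    have h0 := hf0 z
    rw [← r.einsteinLHS_eq z hA' hf' h0, hE z z.2]
    field_simp
    ring
  have hfu : IsUnit f' := isUnit_of_ev_ne_zero _ fun z => hf0 z
  refine ⟨?_, fun ν => ?_⟩
  · rw [trace, r.sum_ginv_mul_eq ⟨y, hy⟩ (hT ⟨y, hy⟩), X.tr_stress hP' hS', map_zero]
  · rw [r.div2_eq ⟨y, hy⟩ hT, X.diver2_stress hP' hS' hfu, map_zero]

end WeylGravity

end

/-! ### Charts of the manifold: smoothness and nondegeneracy of the components. -/

namespace WeylGravity

open Matrix

section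

variable {M : Type*} [TopologicalSpace M] [ChartedSpace E4 M]

theorem mdifferentiable_of_mem_charts {e : OpenPartialHomeomorph M E4} (he : e ∈ charts M) :
    e.MDifferentiable (𝓡 4) (𝓡 4) :=
  ⟨(contMDiffOn_of_mem_maximalAtlas he).mdifferentiableOn (by simp),
    (contMDiffOn_symm_of_mem_maximalAtlas he).mdifferentiableOn (by simp)⟩

theorem contDiffOn_comp0 {e : OpenPartialHomeomorph M E4} (he : e ∈ charts M) {φ : M → ℝ}
    (hφ : ContMDiff (𝓡 4) 𝓘(ℝ, ℝ) ∞ φ) : ContDiffOn ℝ ∞ (comp0 e φ) e.target :=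
  contMDiffOn_iff_contDiffOn.mp (hφ.comp_contMDiffOn (contMDiffOn_symm_of_mem_maximalAtlas he))

theorem sum_smul_coordVec (e : OpenPartialHomeomorph M E4) (y : E4) (v : Fin 4 → ℝ) :
    ∑ μ, v μ • coordVec e y μ
      = mfderiv (𝓡 4) (𝓡 4) e.symm y (WithLp.toLp 2 v : E4) := by
  have : (WithLp.toLp 2 v : E4) = ∑ μ, v μ • (EuclideanSpace.single μ (1 : ℝ) : E4) := by
    ext i; simp [Pi.single_apply]
  rw [this]
  exact (map_sum (mfderiv (𝓡 4) (𝓡 4) e.symm y) _ _ |>.trans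
    (Finset.sum_congr rfl fun μ _ => map_smul (mfderiv (𝓡 4) (𝓡 4) e.symm y) _ _)).symm

/-- Nondegeneracy: pairing with a basis vector of the signature basis reads off a coordinate of `w`
up to sign. -/
theorem IsLorentzMetric.eq_zero {g : TensorField2 M} (hg : IsLorentzMetric g) {x : M}
    {w : TangentSpace (𝓡 4) x} (hw : ∀ u, g x u w = 0) : w = 0 := by
  obtain ⟨b, hb⟩ := hg.signature x
  refine b.ext_elem fun i => ?_
  have h1 := hw (b i)
  rw [← b.sum_repr w, map_sum] at h1
  simp only [map_smul, hb, smul_eq_mul] at h1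
  have h2 : b.repr w i * (if i = 0 then -1 else 1) = 0 := by simpa using h1
  rw [map_zero]
  rcases mul_eq_zero.mp h2 with h | h
  · exact h
  · split_ifs at h <;> norm_num at h

/-- A kernel vector of the component matrix is sent by the differential of the inverse chart to a
tangent vector orthogonal to everything, by surjectivity; that vector vanishes, and injectivity
gives a contradiction. -/
theorem IsLorentzMetric.det_comp2_ne_zero {g : TensorField2 M} (hg : IsLorentzMetric g)
    {e : OpenPartialHomeomorph M E4} (he : e ∈ charts M) {y : E4} (hy : y ∈ e.target) :
    (comp2 e g y).det ≠ 0 := by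
  intro hdet
  obtain ⟨v, hv0, hv⟩ := exists_mulVec_eq_zero_iff.mpr hdet
  have hd := (mdifferentiable_of_mem_charts he).symm
  have hsurj := hd.mfderiv_surjective hy
  have hinj := hd.mfderiv_injective hy
  have hw : mfderiv (𝓡 4) (𝓡 4) e.symm y (WithLp.toLp 2 v : E4) = 0 := by
    refine hg.eq_zero fun u => ?_
    obtain ⟨u', rfl⟩ := hsurj u
    have h1 := sum_smul_coordVec e y (WithLp.ofLp (u' : E4))
    change _ = mfderiv (𝓡 4) (𝓡 4) e.symm y u' at h1
    rw [← h1, ← sum_smul_coordVec]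
    simp only [map_sum, map_smul, _root_.sum_apply, _root_.smul_apply,
      smul_eq_mul, Finset.mul_sum]
    rw [Finset.sum_comm]
    refine Finset.sum_eq_zero fun μ _ => ?_
    have h2 : ∑ ν, comp2 e g y μ ν * v ν = 0 := congrFun hv μ
    rw [← mul_zero (WithLp.ofLp (u' : E4) μ), ← h2, Finset.mul_sum]
    exact Finset.sum_congr rfl fun ν _ => by
      change v ν * (_ * comp2 e g y μ ν) = _
      ring
  have h3 : (WithLp.toLp 2 v : E4) = 0 := hinj (hw.trans (map_zero _).symm)
  exact hv0 (congrArg WithLp.ofLp h3)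

end

end WeylGravity

theorem corollary1 {M : Type*} [TopologicalSpace M] [T2Space M] [ParacompactSpace M]
    [ConnectedSpace M] [ChartedSpace WeylGravity.E4 M] [IsManifold (𝓡 4) ∞ M]
    (om lam β : ℝ)
    (g : WeylGravity.TensorField2 M) (hg : WeylGravity.IsLorentzMetric g)
    (Q : WeylGravity.CovectorField M) (hQ : WeylGravity.SmoothCovector Q)
    (φ : M → ℝ) (hφ : ContMDiff (𝓡 4) 𝓘(ℝ, ℝ) ∞ φ) (hφ0 : ∀ x, φ x ≠ 0)
    (T : WeylGravity.TensorField2 M)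
    (hEinstein : WeylGravity.EinsteinEq om lam β g Q φ T)
    (hProca : WeylGravity.ProcaEq om β g Q φ)
    (hScalar : WeylGravity.ScalarEq om lam g Q φ) :
    WeylGravity.Traceless g T ∧ WeylGravity.RiemannConserved g T := by
  have key : ∀ e ∈ WeylGravity.charts M, ∀ y ∈ e.target,
      WeylGravity.trace (WeylGravity.comp2 e g) (WeylGravity.comp2 e T) y = 0 ∧
      ∀ ν, WeylGravity.div2 (WeylGravity.comp2 e g) (WeylGravity.comp2 e T) ν y = 0 :=
    fun e he y hy => WeylGravity.trace_eq_zero_and_div2_eq_zero e.open_target (hg.smooth e he)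
      (fun _ _ => Matrix.ext fun _ _ => hg.symm _ _ _) (fun _ hz => hg.det_comp2_ne_zero he hz)
      (hQ e he) (WeylGravity.contDiffOn_comp0 he hφ) (fun _ => hφ0 _)
      (hEinstein e he) (hProca e he) (hScalar e he) hy
  exact ⟨fun e he y hy => (key e he y hy).1, fun e he y hy => (key e he y hy).2⟩
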